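/- **Setting.** Let $1\le r\le K$, let $X_1,\dots,X_K$ be real Banach spaces continuously and injectively embedded in $L^2(\mathbb R^N)$ (for instance $X_k=H^1(\mathbb R^N)$), let $X=X_1\times\cdots\times X_K$ with dual $X'$, and write $\langle F,v\rangle$ both for the $L^2$ inner product and for the pairing of $X'$ with $X$. Let $L_{00}:X\to X'$ be a map (in general nonlinear). For $u=(u_1,\dots,u_K)\in X$ put $P_k=\langle u_k,u_k\rangle$ and $Q_j(u)=\sum_{k=1}^K q_{jk}P_k$ ($1\le j\le r$), where $(q_{jk})$ is a real $r\times K$ matrix in reduced echelon form, i.e. $q_{ij}=\delta_{ij}$ for $1\le i,j\le r$. Let $B=\delta Q/\delta u$, with columns $B_j=(2q_{jk}u_k)_{k}$, and let $C\in\mathbb R^r$. Consider $$L_0u\equiv L_{00}u-\frac{\delta Q}{\delta u}\,\vec\mu=0,\qquad Q_j(u)=C_j\quad(1\le j\le r),\qquad \vec\mu\in\mathbb R^r .$$ Let $L_1$ be the linearization of $L_0$ at $u$ with $\vec\mu$ fixed, $L_1^\dagger$ its adjoint, $\langle L_1^\dagger\varphi,\psi\rangle=\langle L_1\psi,\varphi\rangle$,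 and let the acceleration operator $M:X\to X'$ be a Hermitian positive-definite linear isomorphism. **Scheme (PCSOM).** Given $\Delta t>0$ and $u_n$, put, at $u=u_n$, $$\vec\mu_n=\langle B,M^{-1}B\rangle^{-1}\langle B,M^{-1}L_{00}u\rangle,\qquad \vec\gamma_n=\langle B,M^{-1}B\rangle^{-1}\langle B,M^{-1}L_1^\dagger M^{-1}L_0u\rangle\big|_{\vec\mu=\vec\mu_n},$$ $$\hat u_{n+1}=u_n-M^{-1}\bigl[L_1^\dagger M^{-1}L_0u-B\vec\gamma_n\bigr]_{\vec\mu=\vec\mu_n}\Delta t,$$ and then normalize the dependent powers: $$u_{k,n+1}=\left[\frac{C_k-\sum_{l=r+1}^Kq_{kl}\langle\hat u_{l,n+1},\hat u_{l,n+1}\rangle}{\langle\hat u_{k,n+1},\hat u_{k,n+1}\rangle}\right]^{1/2}\hat u_{k,n+1}\ (1\le k\le r),\qquad u_{k,n+1}=\hat u_{k,n+1}\ (r<k\le K).$$ **Hypotheses.** Let $u(c,\vec\mu)$ be a $C^1$ family in $X$, $c=(c_1,\dots,c_s)$ near $c^0$ and $\vec\mu$ near $\vec\mu^0$, such that $u(c,\vec\mu)$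 solves $L_0u=0$ with propagation constants $\vec\mu$. Let $u=u(c^0,\vec\mu^0)$ satisfy $Q_j(u)=C_j$ for all $j$ and $u_k\ne0$ for $1\le k\le r$, and let $L_{00}$ be $C^2$ near $u$. With $B$ and $L_1$ taken at $(u,\vec\mu^0)$, assume that: 1. (Assumption 1) $\ker L_1$ is spanned by the invariance modes $\partial u/\partial c_j$, $1\le j\le s$; 2. the columns of $B$ are orthogonal to $\ker L_1$; 3. $\det(\partial Q_i/\partial\mu_j)\ne0$, the derivatives being taken along $u(c^0,\vec\mu)$ at $\vec\mu^0$. Let $\Lambda_{\min}\le 0$ be the minimum of the spectrum (eigenvalues and continuous spectrum) of $$\mathcal L_{PCG}\Psi=M^{-1}\bigl(\hat L\Psi-B\langle B,M^{-1}B\rangle^{-1}\langle B,M^{-1}\hat L\Psi\rangle\bigr),\quad \hat L\Psi=-L_1^\dagger M^{-1}\bigl(L_1\Psi-B\langle B,M^{-1}B\rangle^{-1}\langle B,M^{-1}L_1\Psi\rangle\bigr),$$ and let $\Delta t_{\max}=-2/\Lambda_{\min}$ (with $\Delta t_{\max}=\infty$ if $\Lambda_{\min}=0$). **Theorem 5.**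 (a) Suppose that the range of $L_1$ is closed (so that zero is not in the continuous spectrum; this is automatic in finite dimensions). If $\Delta t<\Delta t_{\max}$, the scheme converges to the solitary wave whenever the initial condition is close to $u$, up to a small shift of the parameters of the invariance modes: for every $\varepsilon>0$ there is $\delta>0$ such that, for every $u_0\in X$ with $\|u_0-u\|<\delta$, all steps of the scheme are well defined, all iterates stay within $\varepsilon$ of $u$, and $u_n\to u(c,\vec\mu)$ for some $(c,\vec\mu)$ with $\|c-c^0\|<\varepsilon$, $\|\vec\mu-\vec\mu^0\|<\varepsilon$, where $u(c,\vec\mu)$ solves $L_0u=0$ and satisfies $Q_j(u(c,\vec\mu))=C_j$ for all $j$. (b) If $\Delta t>\Delta t_{\max}$, the scheme diverges from $u$: there is $\varepsilon>0$ such that, arbitrarily close to $u$, there are initial conditions $u_0$ from which the scheme is well defined until it reaches an iterate with $\|u_n-u\|\ge\varepsilon$. -/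

import Mathlib

open Set Filter Topology MeasureTheory
open scoped ENNReal

noncomputable section

namespace PCSOM

/-- The real space `L²(ℝᴺ)`, with inner product `⟨f, g⟩ = ∫ f g dx`. -/
abbrev L2 (N : ℕ) : Type := Lp ℝ 2 (volume : Measure (EuclideanSpace ℝ (Fin N)))

/-
Functional setting.  `X k` is the (energy) space of the `k`-th component, continuously embedded
in `L²(ℝᴺ)` by `ι k`; vector functions `u = (u₁, …, u_K)` live in the product `∀ k, X k`.
The dual of the product is written `(∀ k, X k) →L[ℝ] ℝ`, and the `L²` inner product `⟨F, v⟩`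
of the paper, for `F` in the dual and `v` in the product, is the value `F v`.
A differential operator such as `c - Δ` maps the product (copies of `H¹`) to its dual (`H⁻¹`).
-/
variable {N r K : ℕ} {X : Fin K → Type*} [∀ k, NormedAddCommGroup (X k)]
  [∀ k, NormedSpace ℝ (X k)]

/-- The power `P_k = ⟨u_k, u_k⟩` of the `k`-th component. -/
def power (ι : ∀ k, X k →L[ℝ] L2 N) (k : Fin K) (u : ∀ k, X k) : ℝ :=
  inner ℝ (ι k (u k)) (ι k (u k))

/-- The quadratic quantity `Q_j(u) = ∑ₖ q_{jk} P_k`. -/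
def quad (ι : ∀ k, X k →L[ℝ] L2 N) (q : Matrix (Fin r) (Fin K) ℝ) (j : Fin r)
    (u : ∀ k, X k) : ℝ :=
  ∑ k, q j k * power ι k u

/-- The `j`-th column `B_j = δQ_j/δu = (2 q_{jk} u_k)_k` of `B = δQ/δu`, acting on functions by
the `L²` inner product: `⟨B_j, v⟩ = ∑ₖ 2 q_{jk} ⟨u_k, v_k⟩`. -/
def colB (ι : ∀ k, X k →L[ℝ] L2 N) (q : Matrix (Fin r) (Fin K) ℝ) (u : ∀ k, X k)
    (j : Fin r) : (∀ k, X k) →L[ℝ] ℝ :=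
  ∑ k, (2 * q j k) •
    ((innerSL ℝ (ι k (u k))).comp ((ι k).comp (ContinuousLinearMap.proj k)))

/-- `B_j` is the functional derivative of `Q_j`. -/
theorem hasFDerivAt_quad (ι : ∀ k, X k →L[ℝ] L2 N) (q : Matrix (Fin r) (Fin K) ℝ)
    (j : Fin r) (u : ∀ k, X k) : HasFDerivAt (quad ι q j) (colB ι q u j) u := by
  unfold quad colB power
  refine HasFDerivAt.fun_sum fun k _ => ?_
  have h1 : HasFDerivAt (fun v : ∀ k, X k => ι k (v k))
      ((ι k).comp (ContinuousLinearMap.proj k)) u :=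
    ((ι k).comp (ContinuousLinearMap.proj k)).hasFDerivAt
  have h2 := (h1.inner ℝ h1).const_mul (q j k)
  refine h2.congr_fderiv ?_
  ext v
  simp [real_inner_comm]
  ring

/-- `L₀u = L₀₀u - (δQ/δu) μ`. -/
def L0 (ι : ∀ k, X k →L[ℝ] L2 N) (q : Matrix (Fin r) (Fin K) ℝ)
    (L00 : (∀ k, X k) → ((∀ k, X k) →L[ℝ] ℝ)) (μ : Fin r → ℝ) (u : ∀ k, X k) :
    (∀ k, X k) →L[ℝ] ℝ :=
  L00 u - ∑ j, μ j • colB ι q u j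

/-- `L₁`, the linearization of `L₀` (with `μ` fixed) at `u`.  Its Hermitian `L₁†` is
`(L1 …).flip`, since `⟨L₁† φ, ψ⟩ = ⟨φ, L₁ ψ⟩`. -/
def L1 (ι : ∀ k, X k →L[ℝ] L2 N) (q : Matrix (Fin r) (Fin K) ℝ)
    (L00 : (∀ k, X k) → ((∀ k, X k) →L[ℝ] ℝ)) (μ : Fin r → ℝ) (u : ∀ k, X k) :
    (∀ k, X k) →L[ℝ] (∀ k, X k) →L[ℝ] ℝ :=
  fderiv ℝ (L0 ι q L00 μ) u

/-- The `r × r` matrix `⟨B, M⁻¹B⟩`. -/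
def gram (M : (∀ k, X k) ≃L[ℝ] ((∀ k, X k) →L[ℝ] ℝ)) (B : Fin r → ((∀ k, X k) →L[ℝ] ℝ)) :
    Matrix (Fin r) (Fin r) ℝ :=
  Matrix.of fun i j => B i (M.symm (B j))

/-- The `j`-th entry of the vector `⟨B, M⁻¹B⟩⁻¹ ⟨B, M⁻¹F⟩`, as a linear function of `F`. -/
def coef (M : (∀ k, X k) ≃L[ℝ] ((∀ k, X k) →L[ℝ] ℝ)) (B : Fin r → ((∀ k, X k) →L[ℝ] ℝ))
    (j : Fin r) : ((∀ k, X k) →L[ℝ] ℝ) →L[ℝ] ℝ :=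
  ∑ i, (gram M B)⁻¹ j i •
    ((B i).comp (M.symm : ((∀ k, X k) →L[ℝ] ℝ) →L[ℝ] (∀ k, X k)))

/-- The operator `F ↦ B ⟨B, M⁻¹B⟩⁻¹ ⟨B, M⁻¹F⟩`. -/
def projB (M : (∀ k, X k) ≃L[ℝ] ((∀ k, X k) →L[ℝ] ℝ)) (B : Fin r → ((∀ k, X k) →L[ℝ] ℝ)) :
    ((∀ k, X k) →L[ℝ] ℝ) →L[ℝ] ((∀ k, X k) →L[ℝ] ℝ) :=
  ∑ j, (coef M B j).smulRight (B j)

/-- `μ_n = ⟨B, M⁻¹B⟩⁻¹ ⟨B, M⁻¹ L₀₀ u⟩` at `u = u_n`. -/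
def muOf (ι : ∀ k, X k →L[ℝ] L2 N) (q : Matrix (Fin r) (Fin K) ℝ)
    (L00 : (∀ k, X k) → ((∀ k, X k) →L[ℝ] ℝ))
    (M : (∀ k, X k) ≃L[ℝ] ((∀ k, X k) →L[ℝ] ℝ)) (u : ∀ k, X k) : Fin r → ℝ :=
  fun j => coef M (colB ι q u) j (L00 u)

/-- `L₁† M⁻¹ L₀ u` at `u = u_n`, `μ = μ_n`. -/
def force (ι : ∀ k, X k →L[ℝ] L2 N) (q : Matrix (Fin r) (Fin K) ℝ)
    (L00 : (∀ k, X k) → ((∀ k, X k) →L[ℝ] ℝ))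
    (M : (∀ k, X k) ≃L[ℝ] ((∀ k, X k) →L[ℝ] ℝ)) (u : ∀ k, X k) : (∀ k, X k) →L[ℝ] ℝ :=
  (L1 ι q L00 (muOf ι q L00 M u) u).flip (M.symm (L0 ι q L00 (muOf ι q L00 M u) u))

/-- `γ_n = ⟨B, M⁻¹B⟩⁻¹ ⟨B, M⁻¹ L₁† M⁻¹ L₀ u⟩` at `u = u_n`. -/
def gammaOf (ι : ∀ k, X k →L[ℝ] L2 N) (q : Matrix (Fin r) (Fin K) ℝ)
    (L00 : (∀ k, X k) → ((∀ k, X k) →L[ℝ] ℝ))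
    (M : (∀ k, X k) ≃L[ℝ] ((∀ k, X k) →L[ℝ] ℝ)) (u : ∀ k, X k) : Fin r → ℝ :=
  fun j => coef M (colB ι q u) j (force ι q L00 M u)

/-- The unnormalized update `û_{n+1} = u_n - M⁻¹[L₁† M⁻¹ L₀ u - B γ_n] Δt`. -/
def uhat (ι : ∀ k, X k →L[ℝ] L2 N) (q : Matrix (Fin r) (Fin K) ℝ)
    (L00 : (∀ k, X k) → ((∀ k, X k) →L[ℝ] ℝ))
    (M : (∀ k, X k) ≃L[ℝ] ((∀ k, X k) →L[ℝ] ℝ)) (Δt : ℝ) (u : ∀ k, X k) : ∀ k, X k :=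
  u - Δt • M.symm (force ι q L00 M u - ∑ j, gammaOf ι q L00 M u j • colB ι q u j)

/-- The value `C_k - ∑_{l > r} q_{kl} P_l` to which the `k`-th dependent power is normalized
(components are numbered from `0` here, so the independent ones are those with `r ≤ l`). -/
def target (ι : ∀ k, X k →L[ℝ] L2 N) (q : Matrix (Fin r) (Fin K) ℝ) (C : Fin r → ℝ)
    (k : Fin r) (v : ∀ k, X k) : ℝ :=
  C k - ∑ l ∈ Finset.univ.filter (fun l : Fin K => r ≤ (l : ℕ)), q k l * power ι l v

/-- One step `u_n ↦ u_{n+1}` of the scheme: the update followed by the normalization of the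
dependent powers, i.e. of the first `r` components. -/
def step (ι : ∀ k, X k →L[ℝ] L2 N) (q : Matrix (Fin r) (Fin K) ℝ) (C : Fin r → ℝ)
    (L00 : (∀ k, X k) → ((∀ k, X k) →L[ℝ] ℝ))
    (M : (∀ k, X k) ≃L[ℝ] ((∀ k, X k) →L[ℝ] ℝ)) (Δt : ℝ) (u : ∀ k, X k) : ∀ k, X k :=
  fun k =>
    if h : (k : ℕ) < r then
      Real.sqrt (target ι q C ⟨k, h⟩ (uhat ι q L00 M Δt u) / power ι k (uhat ι q L00 M Δt u)) •
        uhat ι q L00 M Δt u k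
    else uhat ι q L00 M Δt u k

/-- All operations in the step from `u` make sense: `L₁` exists at `u`, `⟨B, M⁻¹B⟩` is
invertible, and the square roots are those of quotients of positive numbers. -/
structure StepDefined (ι : ∀ k, X k →L[ℝ] L2 N) (q : Matrix (Fin r) (Fin K) ℝ)
    (C : Fin r → ℝ) (L00 : (∀ k, X k) → ((∀ k, X k) →L[ℝ] ℝ))
    (M : (∀ k, X k) ≃L[ℝ] ((∀ k, X k) →L[ℝ] ℝ)) (Δt : ℝ) (u : ∀ k, X k) : Prop where
  differentiable : DifferentiableAt ℝ L00 u
  gram_det : (gram M (colB ι q u)).det ≠ 0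
  power_pos : ∀ k : Fin K, (k : ℕ) < r → 0 < power ι k (uhat ι q L00 M Δt u)
  target_pos : ∀ k : Fin r, 0 < target ι q C k (uhat ι q L00 M Δt u)

/-- The operator
`L̂_PCG Ψ = - L₁† M⁻¹ (L₁ Ψ - B ⟨B, M⁻¹B⟩⁻¹ ⟨B, M⁻¹ L₁ Ψ⟩)` at the solution `u` for `μ`. -/
def LhatPCG (ι : ∀ k, X k →L[ℝ] L2 N) (q : Matrix (Fin r) (Fin K) ℝ)
    (L00 : (∀ k, X k) → ((∀ k, X k) →L[ℝ] ℝ))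
    (M : (∀ k, X k) ≃L[ℝ] ((∀ k, X k) →L[ℝ] ℝ)) (μ : Fin r → ℝ) (u : ∀ k, X k) :
    (∀ k, X k) →L[ℝ] (∀ k, X k) →L[ℝ] ℝ :=
  -((L1 ι q L00 μ u).flip.comp
    ((M.symm : ((∀ k, X k) →L[ℝ] ℝ) →L[ℝ] (∀ k, X k)).comp
      (L1 ι q L00 μ u - (projB M (colB ι q u)).comp (L1 ι q L00 μ u))))

/-- The iteration operator
`𝓛_PCG Ψ = M⁻¹ (L̂_PCG Ψ - B ⟨B, M⁻¹B⟩⁻¹ ⟨B, M⁻¹ L̂_PCG Ψ⟩)`. -/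
def LPCG (ι : ∀ k, X k →L[ℝ] L2 N) (q : Matrix (Fin r) (Fin K) ℝ)
    (L00 : (∀ k, X k) → ((∀ k, X k) →L[ℝ] ℝ))
    (M : (∀ k, X k) ≃L[ℝ] ((∀ k, X k) →L[ℝ] ℝ)) (μ : Fin r → ℝ) (u : ∀ k, X k) :
    (∀ k, X k) →L[ℝ] (∀ k, X k) :=
  (M.symm : ((∀ k, X k) →L[ℝ] ℝ) →L[ℝ] (∀ k, X k)).comp
    (LhatPCG ι q L00 M μ u - (projB M (colB ι q u)).comp (LhatPCG ι q L00 M μ u))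

/-- `Λ_min`, the minimum of the spectrum (point and continuous) of an operator. -/
def lambdaMin {E : Type*} [NormedAddCommGroup E] [NormedSpace ℝ E] (A : E →L[ℝ] E) : ℝ :=
  sInf (spectrum ℝ A)

/-- `Δt_max = -2 / Λ_min`, for `Λ_min ≤ 0`; it is `∞` when `Λ_min = 0`. -/
def dtMax (Λmin : ℝ) : ℝ≥0∞ := 2 / ENNReal.ofReal (-Λmin)

/-- The matrix `D̂ = (∂Q_i/∂μ_j)` along a family of solutions `u(μ)`. -/
def Dhat (ι : ∀ k, X k →L[ℝ] L2 N) (q : Matrix (Fin r) (Fin K) ℝ)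
    (V : (Fin r → ℝ) → ∀ k, X k) (μ : Fin r → ℝ) : Matrix (Fin r) (Fin r) ℝ :=
  Matrix.of fun i j => fderiv ℝ (fun ν => quad ι q i (V ν)) μ (Pi.single j 1)

/-- The invariance modes `∂u/∂c_j` of a family of solutions `u(c)`. -/
def invarianceMode {s : ℕ} (V : (Fin s → ℝ) → ∀ k, X k) (c : Fin s → ℝ) (j : Fin s) :
    ∀ k, X k :=
  fderiv ℝ V c (Pi.single j 1)

end PCSOM

end

/-!
Write `Q` for the `M`-orthogonal projection onto the common kernel of the columns of `B`. At the
wave, the linearization `D` of the scheme satisfies `Q D = D` and `D Q = Q - Δt A† A`, where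
`A = Q M⁻¹ L₁ Q` and the adjoint is taken for the energy inner product of `M`. So the linearized
scheme is a Landweber iteration for `A`, and `Λ_min = -‖A‖²`.

If `Δt ‖A‖² < 2` and `A` has closed range, the powers of `D` converge to a projection onto
`ker L₁`, the tangent space of the fixed points `u(c, μ(c))` with `Q(u) = C`, so that a Lyapunov
function, the sum of a geometrically weighted orbit, gives convergence to one of them.

If `Δt ‖A‖² > 2`, the powers of `D` grow exactly like `ρⁿ` with `ρ = ‖Q - Δt A† A‖ > 1`. The scheme
differs from its linearization by `O(‖v‖²)`, although it contains `L₁`, a derivative of a merely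
`C²` map, because `L₁†` acts on `L₀ u`, which vanishes at the wave. The error accumulated by an
orbit that grows like `ρⁿ` is then of second order, and the orbit leaves a fixed ball.
-/

noncomputable section

namespace PCSOM

section WeightedOrbitSum

variable {α : Type*} {F : α → α} {φ : α → ℝ} {θ : ℝ}

/-- The sum of `φ` over the first `N` points of the orbit of `x`, weighted by powers of `θ⁻¹`.
It turns a decay of `φ` by the factor `θ ^ N` in `N` steps into a decay by `θ` in each step. -/
def weightedOrbitSum (F : α → α) (φ : α → ℝ) (θ : ℝ) (N : ℕ) (x : α) : ℝ :=
  ∑ j ∈ Finset.range N, θ⁻¹ ^ j * φ (F^[j] x)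

theorem weightedOrbitSum_apply_le (hθ : 0 < θ) {N : ℕ} {x : α}
    (h : φ (F^[N] x) ≤ θ ^ N * φ x) :
    weightedOrbitSum F φ θ N (F x) ≤ θ * weightedOrbitSum F φ θ N x := by
  have hshift : weightedOrbitSum F φ θ N (F x) =
      θ * ∑ j ∈ Finset.range N, θ⁻¹ ^ (j + 1) * φ (F^[j + 1] x) := by
    rw [weightedOrbitSum, Finset.mul_sum]
    refine Finset.sum_congr rfl fun j _ => ?_
    rw [Function.iterate_succ_apply, pow_succ]
    field_simp
  have htelescope : ∑ j ∈ Finset.range N, θ⁻¹ ^ (j + 1) * φ (F^[j + 1] x) + φ x =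
      weightedOrbitSum F φ θ N x + θ⁻¹ ^ N * φ (F^[N] x) := by
    simpa [weightedOrbitSum, Finset.sum_range_succ] using
      (Finset.sum_range_succ' (fun j => θ⁻¹ ^ j * φ (F^[j] x)) N).symm
  have hlast : θ⁻¹ ^ N * φ (F^[N] x) ≤ φ x := by
    rwa [inv_pow, inv_mul_le_iff₀ (by positivity)]
  rw [hshift]
  exact mul_le_mul_of_nonneg_left (by linarith) hθ.le

theorem le_weightedOrbitSum (hθ : 0 ≤ θ) (hφ : ∀ x, 0 ≤ φ x) {N : ℕ} (hN : 0 < N) (x : α) :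
    φ x ≤ weightedOrbitSum F φ θ N x := by
  simpa [weightedOrbitSum] using Finset.single_le_sum (f := fun j => θ⁻¹ ^ j * φ (F^[j] x))
    (fun j _ => mul_nonneg (by positivity) (hφ _)) (Finset.mem_range.2 hN)

end WeightedOrbitSum

section Lyapunov

variable {α : Type*} [PseudoMetricSpace α] {F : α → α} {V φ : α → ℝ} {u : α} {θ C : ℝ}

theorem iterate_mem_ball_of_lyapunov (hθ0 : 0 ≤ θ) (hθ1 : θ < 1) (hC : 0 ≤ C) {R : ℝ}
    (hF : ∀ x ∈ Metric.ball u R, V (F x) ≤ θ * V x ∧ dist (F x) x ≤ C * V x) {x₀ : α}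
    (hx₀ : dist x₀ u + C * V x₀ / (1 - θ) < R) (hV₀ : 0 ≤ V x₀) (n : ℕ) :
    V (F^[n] x₀) ≤ θ ^ n * V x₀ ∧ F^[n] x₀ ∈ Metric.ball u R := by
  have h1θ : 0 < 1 - θ := sub_pos.2 hθ1
  set a := C * V x₀ / (1 - θ) with ha
  have ha0 : 0 ≤ a := by positivity
  suffices h : V (F^[n] x₀) ≤ θ ^ n * V x₀ ∧ dist (F^[n] x₀) u ≤ dist x₀ u + a * (1 - θ ^ n) by
    have hθn : 0 ≤ a * θ ^ n := by positivity
    exact ⟨h.1, Metric.mem_ball.2 (by linarith [h.2])⟩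
  induction n with
  | zero => simp
  | succ n ih =>
    have hθn : 0 ≤ a * θ ^ n := by positivity
    obtain ⟨hV, hdist⟩ := hF (F^[n] x₀) (Metric.mem_ball.2 (by linarith [ih.2]))
    rw [Function.iterate_succ_apply']
    constructor
    · calc V (F (F^[n] x₀)) ≤ θ * (θ ^ n * V x₀) :=
            hV.trans (mul_le_mul_of_nonneg_left ih.1 hθ0)
        _ = θ ^ (n + 1) * V x₀ := by ring
    · calc dist (F (F^[n] x₀)) u ≤ dist (F (F^[n] x₀)) (F^[n] x₀) + dist (F^[n] x₀) u :=
            dist_triangle _ _ _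
        _ ≤ C * (θ ^ n * V x₀) + (dist x₀ u + a * (1 - θ ^ n)) :=
            add_le_add (hdist.trans (mul_le_mul_of_nonneg_left ih.1 hC)) ih.2
        _ = dist x₀ u + a * (1 - θ ^ (n + 1)) := by rw [ha]; field_simp; ring

theorem eventually_tendsto_iterate_of_lyapunov [CompleteSpace α] (hθ0 : 0 ≤ θ) (hθ1 : θ < 1)
    (hC : 0 ≤ C) (hV0 : ∀ x, 0 ≤ V x) (hVu : Tendsto V (𝓝 u) (𝓝 0))
    (hVF : ∀ᶠ x in 𝓝 u, V (F x) ≤ θ * V x) (hFV : ∀ᶠ x in 𝓝 u, dist (F x) x ≤ C * V x)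
    {t : Set α} (ht : t ∈ 𝓝 u) :
    ∀ᶠ x₀ in 𝓝 u, (∀ n, F^[n] x₀ ∈ t) ∧ (∀ n, V (F^[n] x₀) ≤ θ ^ n * V x₀) ∧
      ∃ x ∈ t, Tendsto (fun n => F^[n] x₀) atTop (𝓝 x) := by
  obtain ⟨R, hR, hball⟩ := Metric.nhds_basis_closedBall.eventually_iff.1 (hVF.and (hFV.and ht))
  have hlim : Tendsto (fun x => dist x u + C * V x / (1 - θ)) (𝓝 u) (𝓝 0) := by
    simpa using (tendsto_id.dist (tendsto_const_nhds (x := u))).add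
      ((hVu.const_mul C).div_const (1 - θ))
  filter_upwards [hlim.eventually (gt_mem_nhds hR)] with x₀ hx₀
  have horbit := iterate_mem_ball_of_lyapunov hθ0 hθ1 hC
    (fun x hx => ⟨(hball (Metric.ball_subset_closedBall hx)).1,
      (hball (Metric.ball_subset_closedBall hx)).2.1⟩) hx₀ (hV0 x₀)
  have hmem : ∀ n, F^[n] x₀ ∈ Metric.closedBall u R := fun n =>
    Metric.ball_subset_closedBall (horbit n).2
  have hcauchy : CauchySeq fun n => F^[n] x₀ := by
    refine cauchySeq_of_le_geometric θ (C * V x₀) hθ1 fun n => ?_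
    rw [dist_comm, Function.iterate_succ_apply']
    calc dist (F (F^[n] x₀)) (F^[n] x₀) ≤ C * (θ ^ n * V x₀) :=
          (hball (hmem n)).2.1.trans (mul_le_mul_of_nonneg_left (horbit n).1 hC)
      _ = C * V x₀ * θ ^ n := by ring
  obtain ⟨x, hx⟩ := cauchySeq_tendsto_of_complete hcauchy
  exact ⟨fun n => (hball (hmem n)).2.2, fun n => (horbit n).1, x,
    (hball (Metric.isClosed_closedBall.mem_of_tendsto hx (.of_forall hmem))).2.2, hx⟩

theorem eventually_tendsto_iterate_of_pow_decay [CompleteSpace α] (hθ0 : 0 < θ) (hθ1 : θ < 1)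
    (hC : 0 ≤ C) (hφ0 : ∀ x, 0 ≤ φ x) (hφu : Tendsto φ (𝓝 u) (𝓝 0))
    (hFu : Tendsto F (𝓝 u) (𝓝 u)) {N : ℕ} (hN : 0 < N)
    (hφF : ∀ᶠ x in 𝓝 u, φ (F^[N] x) ≤ θ ^ N * φ x)
    (hFφ : ∀ᶠ x in 𝓝 u, dist (F x) x ≤ C * φ x) {t : Set α} (ht : t ∈ 𝓝 u) :
    ∀ᶠ x₀ in 𝓝 u, (∀ n, F^[n] x₀ ∈ t) ∧ Tendsto (fun n => φ (F^[n] x₀)) atTop (𝓝 0) ∧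
      ∃ x ∈ t, Tendsto (fun n => F^[n] x₀) atTop (𝓝 x) := by
  have hφV : ∀ x, φ x ≤ weightedOrbitSum F φ θ N x := le_weightedOrbitSum hθ0.le hφ0 hN
  have hVu : Tendsto (weightedOrbitSum F φ θ N) (𝓝 u) (𝓝 0) := by
    rw [← Finset.sum_const_zero (s := Finset.range N)]
    refine tendsto_finsetSum _ fun j _ => ?_
    simpa using (hφu.comp (hFu.iterate j)).const_mul (θ⁻¹ ^ j)
  filter_upwards [eventually_tendsto_iterate_of_lyapunov hθ0.le hθ1 hC
    (fun x => (hφ0 x).trans (hφV x)) hVu (hφF.mono fun x => weightedOrbitSum_apply_le hθ0)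
    (hFφ.mono fun x hx => hx.trans (mul_le_mul_of_nonneg_left (hφV x) hC)) ht]
    with x₀ ⟨hmem, hdecay, hlim⟩
  refine ⟨hmem, squeeze_zero (fun n => hφ0 _) (fun n => (hφV _).trans (hdecay n)) ?_, hlim⟩
  simpa using (tendsto_pow_atTop_nhds_zero_of_lt_one hθ0.le hθ1).mul_const
    (weightedOrbitSum F φ θ N x₀)

end Lyapunov

section FixedPointFamily

variable {E V : Type*} [NormedAddCommGroup E] [NormedSpace ℝ E]
  [NormedAddCommGroup V] [NormedSpace ℝ V] {F : E → E} {D P : E →L[ℝ] E} {w : V → E}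
  {W : V →L[ℝ] E} {v₀ : V}

theorem exists_eventually_leftInverse [CompleteSpace V] {π : E →L[ℝ] V}
    (hw : HasStrictFDerivAt w W v₀) (hπ : π.comp W = .id ℝ V) :
    ∃ κ : E → V, HasStrictFDerivAt κ π (w v₀) ∧ ∀ᶠ v in 𝓝 v₀, κ (w v) = v := by
  have hd : HasStrictFDerivAt (fun v => π (w v))
      ((ContinuousLinearEquiv.refl ℝ V : V ≃L[ℝ] V) : V →L[ℝ] V) v₀ := by
    simpa [hπ] using π.hasStrictFDerivAt.comp v₀ hw
  refine ⟨fun x => hd.localInverse _ _ _ (π x), ?_, hd.eventually_left_inverse⟩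
  exact hd.to_localInverse.comp (w v₀) π.hasStrictFDerivAt

theorem exists_norm_sub_mul_pow_lt_one (hD : Tendsto (fun n => D ^ n) atTop (𝓝 P))
    (hP : P * P = P) : ∃ n > 0, ‖(1 - P) * D ^ n‖ < 1 := by
  have hlim : Tendsto (fun n => ‖(1 - P) * D ^ n‖) atTop (𝓝 0) := by
    simpa [sub_mul, hP] using (hD.const_mul (1 - P)).norm
  exact ((eventually_gt_atTop 0).and (hlim.eventually (gt_mem_nhds one_pos))).exists

theorem eventually_norm_comp_le_of_eqOn_retract {G : Type*} [NormedAddCommGroup G]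
    [NormedSpace ℝ G] {f : E → G} {f' : E →L[ℝ] G} {p : E → E} {u : E} {K : NNReal}
    (hf : HasStrictFDerivAt f f' u) (hK : ‖f'‖₊ < K) (hp : Tendsto p (𝓝 u) (𝓝 u))
    (hfp : ∀ᶠ x in 𝓝 u, f (p x) = 0) : ∀ᶠ x in 𝓝 u, ‖f x‖ ≤ K * ‖x - p x‖ := by
  obtain ⟨s, hs, hlip⟩ := hf.exists_lipschitzOnWith_of_nnnorm_lt K hK
  filter_upwards [hs, hp hs, hfp] with x hx hpx h0
  simpa [h0] using hlip.norm_sub_le hx hpx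

theorem eventually_tendsto_iterate_of_retract [CompleteSpace E] {p : E → E} {u : E}
    (hF : HasStrictFDerivAt F D u) (hp : HasStrictFDerivAt p P u) (hpu : p u = u)
    (hFp : ∀ᶠ x in 𝓝 u, F (p x) = p x) (hpp : ∀ᶠ x in 𝓝 u, p (p x) = p x) {N : ℕ} (hN : 0 < N)
    (hDN : ‖(1 - P) * D ^ N‖ < 1) {t : Set E} (ht : t ∈ 𝓝 u) :
    ∀ᶠ x₀ in 𝓝 u, (∀ n, F^[n] x₀ ∈ t) ∧
      ∃ x ∈ t, p x = x ∧ Tendsto (fun n => F^[n] x₀) atTop (𝓝 x) := by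
  have hFu : F u = u := by simpa [hpu] using hFp.self_of_nhds
  have hpt : Tendsto p (𝓝 u) (𝓝 u) := by simpa [hpu] using hp.continuousAt.tendsto
  have hFt : Tendsto F (𝓝 u) (𝓝 u) := by simpa [hFu] using hF.continuousAt.tendsto
  obtain ⟨θ, hθN, hθ1, hθ0⟩ : ∃ θ : ℝ, ‖(1 - P) * D ^ N‖ < θ ^ N ∧ θ < 1 ∧ 0 < θ := by
    have hpow : Tendsto (fun θ : ℝ => θ ^ N) (𝓝[<] 1) (𝓝 1) := by
      simpa using ((continuous_pow N).tendsto (1 : ℝ)).mono_left nhdsWithin_le_nhds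
    exact ((hpow.eventually (lt_mem_nhds hDN)).and (eventually_mem_nhdsWithin.and
      (nhdsWithin_le_nhds (lt_mem_nhds one_pos)))).exists
  have hψ : HasStrictFDerivAt (fun x => x - p x) (1 - P) u := (hasStrictFDerivAt_id u).sub hp
  have hψu : Tendsto (fun x => ‖x - p x‖) (𝓝 u) (𝓝 0) := by
    simpa [hpu] using hψ.continuousAt.norm.tendsto
  have hdecay : ∀ᶠ x in 𝓝 u, ‖F^[N] x - p (F^[N] x)‖ ≤ θ ^ N * ‖x - p x‖ := by
    have hψN : HasStrictFDerivAt (fun x => F^[N] x - p (F^[N] x)) ((1 - P) * D ^ N) u := by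
      have hFN := hF.iterate hFu N
      rw [← Function.iterate_fixed hFu N] at hψ
      exact hψ.comp u hFN
    refine eventually_norm_comp_le_of_eqOn_retract hψN
      (K := ⟨θ ^ N, by positivity⟩) (by exact_mod_cast hθN) hpt ?_
    filter_upwards [hFp, hpp] with x hFx hpx
    rw [Function.iterate_fixed hFx, hpx, sub_self]
  have hdisp : ∀ᶠ x in 𝓝 u, dist (F x) x ≤ ↑(‖D - 1‖₊ + 1) * ‖x - p x‖ := by
    simp only [dist_eq_norm]
    exact eventually_norm_comp_le_of_eqOn_retract (hF.sub (hasStrictFDerivAt_id u))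
      (lt_add_one _) hpt (hFp.mono fun x hx => by rw [hx, sub_self])
  obtain ⟨L, s, hs, hlip⟩ := hψ.exists_lipschitzOnWith
  filter_upwards [eventually_tendsto_iterate_of_pow_decay hθ0 hθ1 (NNReal.coe_nonneg _)
    (fun x => norm_nonneg _) hψu hFt hN hdecay hdisp (inter_mem ht (interior_mem_nhds.2 hs))]
    with x₀ ⟨hmem, hlim0, x, ⟨hxt, hxs⟩, hlim⟩
  refine ⟨fun n => (hmem n).1, x, hxt, ?_, hlim⟩
  have hcont := (hlip.continuousOn.continuousAt (mem_interior_iff_mem_nhds.1 hxs)).norm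
  have hx0 := tendsto_nhds_unique hlim0 (hcont.tendsto.comp hlim)
  exact (sub_eq_zero.1 (norm_eq_zero.1 hx0.symm)).symm

theorem eventually_tendsto_family_of_leftInverse [CompleteSpace E] [CompleteSpace V]
    {π : E →L[ℝ] V} (hF : HasStrictFDerivAt F D (w v₀)) (hw : HasStrictFDerivAt w W v₀)
    (hFw : ∀ᶠ v in 𝓝 v₀, F (w v) = w v) (hπ : π.comp W = .id ℝ V)
    (hD : Tendsto (fun n => D ^ n) atTop (𝓝 (W.comp π))) {t : Set E} (ht : t ∈ 𝓝 (w v₀))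
    {s : Set V} (hs : s ∈ 𝓝 v₀) :
    ∀ᶠ x₀ in 𝓝 (w v₀), (∀ n, F^[n] x₀ ∈ t) ∧
      ∃ v ∈ s, Tendsto (fun n => F^[n] x₀) atTop (𝓝 (w v)) := by
  obtain ⟨κ, hκ, hκw⟩ := exists_eventually_leftInverse hw hπ
  have hκ₀ : κ (w v₀) = v₀ := hκw.self_of_nhds
  have hκt : Tendsto κ (𝓝 (w v₀)) (𝓝 v₀) := by simpa [hκ₀] using hκ.continuousAt.tendsto
  have hp : HasStrictFDerivAt (fun x => w (κ x)) (W.comp π) (w v₀) := by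
    rw [← hκ₀] at hw
    exact hw.comp (w v₀) hκ
  have hP : W.comp π * W.comp π = W.comp π := by
    ext x
    simpa using congrArg W (DFunLike.congr_fun hπ (π x))
  obtain ⟨N, hN, hDN⟩ := exists_norm_sub_mul_pow_lt_one hD hP
  have hpp : ∀ᶠ x in 𝓝 (w v₀), w (κ (w (κ x))) = w (κ x) :=
    hκt.eventually (p := fun v => w (κ (w v)) = w v) (hκw.mono fun v hv => by rw [hv])
  filter_upwards [eventually_tendsto_iterate_of_retract hF hp (by rw [hκ₀])
    (hκt.eventually hFw) hpp hN hDN (inter_mem ht (hκt hs))]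
    with x₀ ⟨hmem, x, ⟨_, hxs⟩, hx, hlim⟩
  exact ⟨fun n => (hmem n).1, κ x, hxs, by rwa [hx]⟩

theorem eventually_tendsto_family [CompleteSpace E] [FiniteDimensional ℝ V]
    (hF : HasStrictFDerivAt F D (w v₀)) (hw : HasStrictFDerivAt w W v₀)
    (hFw : ∀ᶠ v in 𝓝 v₀, F (w v) = w v) (hD : Tendsto (fun n => D ^ n) atTop (𝓝 P))
    (hP : ∀ x, P x ∈ range W) {t : Set E} (ht : t ∈ 𝓝 (w v₀)) {s : Set V} (hs : s ∈ 𝓝 v₀) :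
    ∀ᶠ x₀ in 𝓝 (w v₀), (∀ n, F^[n] x₀ ∈ t) ∧
      ∃ v ∈ s, Tendsto (fun n => F^[n] x₀) atTop (𝓝 (w v)) := by
  have hDW : D.comp W = W :=
    ((hF.comp v₀ hw).hasFDerivAt.congr_of_eventuallyEq
      (hFw.mono fun v hv => hv.symm)).unique hw.hasFDerivAt
  have hDnW : ∀ n v, (D ^ n) (W v) = W v := fun n v => by
    induction n with
    | zero => rfl
    | succ n ih => rw [pow_succ', mul_apply_eq_comp, ih]; exact DFunLike.congr_fun hDW v
  have hPW : ∀ v, P (W v) = W v := fun v => by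
    refine tendsto_nhds_unique
      ((ContinuousLinearMap.apply ℝ E (W v)).continuous.continuousAt.tendsto.comp hD) ?_
    simp [Function.comp_def, hDnW]
  -- `W` need not be injective, so the family is reparametrized by the range of `W`.
  obtain ⟨g, hg⟩ := W.rangeRestrict.exists_rightInverse_of_surjective W.range_rangeRestrict
  have hWg : ∀ y : W.range, W (g y) = y := fun y => congrArg Subtype.val (DFunLike.congr_fun hg y)
  have hγ : HasStrictFDerivAt (fun y => v₀ + g y) g 0 := g.hasStrictFDerivAt.const_add v₀
  have hγt : Tendsto (fun y => v₀ + g y) (𝓝 0) (𝓝 v₀) := by simpa using hγ.continuousAt.tendsto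
  have hγ₀ : v₀ + g 0 = v₀ := by simp
  have hw' : HasStrictFDerivAt (fun y => w (v₀ + g y)) W.range.subtypeL 0 := by
    rw [← hγ₀] at hw
    exact (hw.comp 0 hγ).congr_fderiv (ContinuousLinearMap.ext hWg)
  have hπ : (P.codRestrict W.range hP).comp W.range.subtypeL = .id ℝ W.range := by
    ext ⟨_, v, rfl⟩
    exact hPW v
  have key := eventually_tendsto_family_of_leftInverse (w := fun y => w (v₀ + g y))
    (π := P.codRestrict W.range hP) (by rwa [hγ₀]) hw' (hγt.eventually hFw) hπ hD (by rwa [hγ₀])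
    (hγt hs)
  rw [hγ₀] at key
  filter_upwards [key] with x₀ ⟨hmem, y, hy, hlim⟩
  exact ⟨hmem, _, hy, hlim⟩

end FixedPointFamily

section QuadraticError

open Asymptotics

variable {E F G : Type*} [NormedAddCommGroup E] [NormedSpace ℝ E] [NormedAddCommGroup F]
  [NormedSpace ℝ F] [NormedAddCommGroup G] [NormedSpace ℝ G] {f : E → F} {f' : E →L[ℝ] F} {u : E}

/-- `f` is approximated near `u` by its linearization `f'` up to an error quadratic in the
distance to `u`, as a `C²` function is; the iteration map is known to have this property only at
the solution, being merely `C¹` near it. -/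
def HasQuadraticError (f : E → F) (f' : E →L[ℝ] F) (u : E) : Prop :=
  (fun x => f x - f u - f' (x - u)) =O[𝓝 u] fun x => ‖x - u‖ ^ 2

namespace HasQuadraticError

theorem hasFDerivAt (h : HasQuadraticError f f' u) : HasFDerivAt f f' u :=
  .of_isLittleO (h.trans_isLittleO (isLittleO_pow_sub_sub u one_lt_two))

theorem isBigO_sub (h : HasQuadraticError f f' u) : (fun x => f x - f u) =O[𝓝 u] (· - u) :=
  h.hasFDerivAt.isBigO_sub

theorem congr_of_eventuallyEq {g : E → F} (h : HasQuadraticError f f' u) (hgf : g =ᶠ[𝓝 u] f) :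
    HasQuadraticError g f' u := by
  refine IsBigO.congr' h ?_ .rfl
  filter_upwards [hgf] with x hx
  rw [hx, hgf.self_of_nhds]

theorem sub {g : E → F} {g' : E →L[ℝ] F} (hf : HasQuadraticError f f' u)
    (hg : HasQuadraticError g g' u) : HasQuadraticError (fun x => f x - g x) (f' - g') u := by
  refine (IsBigO.sub hf hg).congr_left fun x => ?_
  simp only [sub_apply]
  abel

theorem clm (L : E →L[ℝ] F) (u : E) : HasQuadraticError L L u :=
  (isBigO_zero _ _).congr_left fun x => by simp

theorem clm_comp (L : F →L[ℝ] G) (hf : HasQuadraticError f f' u) :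
    HasQuadraticError (fun x => L (f x)) (L.comp f') u :=
  ((L.isBigO_comp _ _).trans hf).congr_left fun x => by simp

theorem comp {g : F → G} {g' : F →L[ℝ] G} (hg : HasQuadraticError g g' (f u))
    (hf : HasQuadraticError f f' u) : HasQuadraticError (fun x => g (f x)) (g'.comp f') u := by
  have houter : (fun x => g (f x) - g (f u) - g' (f x - f u)) =O[𝓝 u] fun x => ‖x - u‖ ^ 2 :=
    (IsBigO.comp_tendsto hg hf.hasFDerivAt.continuousAt.tendsto).trans
      (hf.isBigO_sub.norm_norm.pow 2)
  refine (houter.add ((g'.isBigO_comp _ _).trans hf)).congr_left fun x => ?_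
  simp

theorem clm_apply_of_eq_zero {a : E → F →L[ℝ] G} (ha : (fun x => a x - a u) =O[𝓝 u] (· - u))
    (hf : HasQuadraticError f f' u) (hfu : f u = 0) :
    HasQuadraticError (fun x => a x (f x)) ((a u).comp f') u := by
  have hvar : (fun x => (a x - a u) (f x)) =O[𝓝 u] fun x => ‖x - u‖ ^ 2 := by
    have hf0 : f =O[𝓝 u] (· - u) := hf.isBigO_sub.congr_left fun x => by rw [hfu, sub_zero]
    refine (IsBigO.of_norm_le fun x => (a x - a u).le_opNorm (f x)).trans ?_
    simpa only [sq] using ha.norm_norm.mul hf0.norm_norm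
  refine (hvar.add (((a u).isBigO_comp _ _).trans hf)).congr_left fun x => ?_
  simp [hfu]

theorem of_contDiffAt (hf : ContDiffAt ℝ 2 f u) : HasQuadraticError f (fderiv ℝ f u) u := by
  have hfderiv : ContDiffAt ℝ 1 (fderiv ℝ f) u := hf.fderiv_right (by norm_num)
  obtain ⟨K, hK0, hK⟩ :=
    (hfderiv.differentiableAt one_ne_zero).hasFDerivAt.isBigO_sub.exists_nonneg
  have hdiff : ∀ᶠ x in 𝓝 u, DifferentiableAt ℝ f x :=
    (hf.eventually (by simp)).mono fun x hx => hx.differentiableAt two_ne_zero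
  obtain ⟨R, hR, hball⟩ := Metric.eventually_nhds_iff_ball.1 (hK.bound.and hdiff)
  refine IsBigO.of_bound K ?_
  filter_upwards [Metric.ball_mem_nhds u hR] with x hx
  have hsub : Metric.closedBall u ‖x - u‖ ⊆ Metric.ball u R :=
    Metric.closedBall_subset_ball (mem_ball_iff_norm.1 hx)
  calc ‖f x - f u - fderiv ℝ f u (x - u)‖ ≤ K * ‖x - u‖ * ‖x - u‖ :=
        (convex_closedBall u ‖x - u‖).norm_image_sub_le_of_norm_fderiv_le' (𝕜 := ℝ)
          (fun y hy => (hball y (hsub hy)).2)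
          (fun y hy => (hball y (hsub hy)).1.trans
            (mul_le_mul_of_nonneg_left (mem_closedBall_iff_norm.1 hy) hK0))
          (by simp) (by simp [dist_eq_norm])
    _ = K * ‖‖x - u‖ ^ 2‖ := by rw [norm_pow, norm_norm]; ring

end HasQuadraticError

end QuadraticError

section Escape

variable {E : Type*} [NormedAddCommGroup E] [NormedSpace ℝ E] {D : E →L[ℝ] E} {ρ C : ℝ}

theorem sub_pow_apply_eq_sum (D : E →L[ℝ] E) (y : ℕ → E) (m : ℕ) :
    y m - (D ^ m) (y 0) = ∑ j ∈ Finset.range m, (D ^ (m - 1 - j)) (y (j + 1) - D (y j)) := by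
  induction m with
  | zero => simp
  | succ m ih =>
    have hstep : ∑ j ∈ Finset.range m, (D ^ (m - j)) (y (j + 1) - D (y j)) =
        D (∑ j ∈ Finset.range m, (D ^ (m - 1 - j)) (y (j + 1) - D (y j))) := by
      rw [map_sum]
      refine Finset.sum_congr rfl fun j hj => ?_
      rw [← mul_apply_eq_comp, ← pow_succ']
      congr 2
      have := Finset.mem_range.1 hj
      omega
    rw [Finset.sum_range_succ, Nat.add_sub_cancel, hstep, ← ih]
    simp [pow_succ']

theorem norm_sub_pow_apply_le (hρ : 1 < ρ) (hD : ∀ n, ‖D ^ n‖ ≤ C * ρ ^ n) {y : ℕ → E} {β : ℝ}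
    (hβ : 0 ≤ β) {m : ℕ} (hy : ∀ j < m, ‖y (j + 1) - D (y j)‖ ≤ β * (ρ ^ j) ^ 2) :
    ‖y m - (D ^ m) (y 0)‖ ≤ C * β / (ρ - 1) * (ρ ^ m) ^ 2 := by
  have hρ0 : 0 < ρ := one_pos.trans hρ
  have hρ1 : 0 < ρ - 1 := sub_pos.2 hρ
  have hC : 0 ≤ C := by simpa using (norm_nonneg _).trans (hD 0)
  rw [sub_pow_apply_eq_sum]
  calc ‖∑ j ∈ Finset.range m, (D ^ (m - 1 - j)) (y (j + 1) - D (y j))‖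
      ≤ ∑ j ∈ Finset.range m, C * β * ρ ^ m * ρ ^ j := by
        refine norm_sum_le_of_le _ fun j hj => ?_
        have hjm := Finset.mem_range.1 hj
        calc _ ≤ C * ρ ^ (m - 1 - j) * (β * (ρ ^ j) ^ 2) :=
              (D ^ (m - 1 - j)).le_of_opNorm_le_of_le (hD _) (hy j hjm)
          _ = C * β * ρ ^ (m - 1 - j + j) * ρ ^ j := by ring
          _ ≤ C * β * ρ ^ m * ρ ^ j := by gcongr <;> first | exact hρ.le | omega
    _ = C * β * ρ ^ m * ((ρ ^ m - 1) / (ρ - 1)) := by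
        rw [← Finset.mul_sum, geom_sum_eq hρ.ne']
    _ ≤ C * β * ρ ^ m * (ρ ^ m / (ρ - 1)) := by gcongr; linarith
    _ = C * β / (ρ - 1) * (ρ ^ m) ^ 2 := by ring

theorem norm_orbit_sub_pow_apply_le {F : E → E} {u x : E} {a b η R : ℝ} (hρ : 1 < ρ) (ha : 0 ≤ a)
    (hb : 0 ≤ b) (hD : ∀ n, ‖D ^ n‖ ≤ C * ρ ^ n)
    (hF : ∀ x ∈ Metric.ball u R, ‖F x - u - D (x - u)‖ ≤ b * ‖x - u‖ ^ 2) (hx : ‖x - u‖ ≤ a)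
    {K : ℝ} (hK : K = C * (b * (2 * C) ^ 2) / (ρ - 1)) (hηR : 2 * C * η < R) (hηC : K * η ≤ C)
    {n : ℕ} (hn : a * ρ ^ n ≤ η) {m : ℕ} (hm : m ≤ n) :
    ‖F^[m] x - u - (D ^ m) (x - u)‖ ≤ K * (a * ρ ^ m) ^ 2 ∧
      ‖F^[m] x - u‖ ≤ 2 * C * (a * ρ ^ m) ∧ F^[m] x ∈ Metric.ball u R := by
  have hC : 0 ≤ C := by simpa using (norm_nonneg _).trans (hD 0)
  have hK0 : 0 ≤ K := by rw [hK]; have := sub_pos.2 hρ; positivity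
  have haρ : ∀ j, 0 ≤ a * ρ ^ j := fun j => by have := one_pos.trans hρ; positivity
  induction m using Nat.strong_induction_on with
  | _ m ih =>
    have hmη : a * ρ ^ m ≤ η :=
      (mul_le_mul_of_nonneg_left (pow_le_pow_right₀ hρ.le hm) ha).trans hn
    have herror : ∀ j < m, ‖F^[j + 1] x - u - D (F^[j] x - u)‖ ≤
        b * (2 * C * a) ^ 2 * (ρ ^ j) ^ 2 := fun j hj => by
      obtain ⟨-, hsize, hball⟩ := ih j hj (hj.le.trans hm)
      rw [Function.iterate_succ_apply']
      calc _ ≤ b * ‖F^[j] x - u‖ ^ 2 := hF _ hball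
        _ ≤ b * (2 * C * (a * ρ ^ j)) ^ 2 := by gcongr
        _ = b * (2 * C * a) ^ 2 * (ρ ^ j) ^ 2 := by ring
    have hdev : ‖F^[m] x - u - (D ^ m) (x - u)‖ ≤ K * (a * ρ ^ m) ^ 2 := by
      calc _ ≤ C * (b * (2 * C * a) ^ 2) / (ρ - 1) * (ρ ^ m) ^ 2 :=
            norm_sub_pow_apply_le hρ hD (y := fun j => F^[j] x - u) (by positivity) herror
        _ = K * (a * ρ ^ m) ^ 2 := by rw [hK]; ring
    have hsize : ‖F^[m] x - u‖ ≤ 2 * C * (a * ρ ^ m) := by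
      calc ‖F^[m] x - u‖ ≤ ‖F^[m] x - u - (D ^ m) (x - u)‖ + ‖(D ^ m) (x - u)‖ :=
            norm_le_norm_sub_add _ _
        _ ≤ K * (a * ρ ^ m) ^ 2 + C * ρ ^ m * a :=
            add_le_add hdev ((D ^ m).le_of_opNorm_le_of_le (hD m) hx)
        _ ≤ C * (a * ρ ^ m) + C * ρ ^ m * a := by
            rw [sq, ← mul_assoc]
            gcongr
            exact (mul_le_mul_of_nonneg_left hmη hK0).trans hηC
        _ = 2 * C * (a * ρ ^ m) := by ring
    refine ⟨hdev, hsize, mem_ball_iff_norm.2 (hsize.trans_lt (lt_of_le_of_lt ?_ hηR))⟩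
    gcongr

theorem exists_small_vector_growing_to {c η δ : ℝ} (hρ : 1 < ρ) (hc : 0 < c)
    (hD : ∃ᶠ n in atTop, c * ρ ^ n ≤ ‖D ^ n‖) (hη : 0 < η) (hδ : 0 < δ) :
    ∃ (n : ℕ) (a : ℝ) (z : E), 0 ≤ a ∧ a < δ ∧ a * ρ ^ n = η ∧ ‖z‖ ≤ a ∧
      c / 2 * η ≤ ‖(D ^ n) z‖ := by
  have hρ0 : 0 < ρ := one_pos.trans hρ
  obtain ⟨n, hn, hnδ⟩ : ∃ n, c * ρ ^ n ≤ ‖D ^ n‖ ∧ η * (ρ ^ n)⁻¹ < δ := by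
    refine (hD.and_eventually (Tendsto.eventually ?_ (gt_mem_nhds hδ))).exists
    simpa using (tendsto_pow_atTop_atTop_of_one_lt hρ).inv_tendsto_atTop.const_mul η
  obtain ⟨v, hv, hDv⟩ := (D ^ n).exists_lt_apply_of_lt_opNorm
    (show c / 2 * ρ ^ n < ‖D ^ n‖ from lt_of_lt_of_le (by gcongr; linarith) hn)
  set a := η * (ρ ^ n)⁻¹ with ha
  have ha0 : 0 ≤ a := by positivity
  have haη : a * ρ ^ n = η := by rw [ha]; field_simp
  refine ⟨n, a, a • v, ha0, hnδ, haη, ?_, ?_⟩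
  · rw [norm_smul, Real.norm_of_nonneg ha0]
    exact mul_le_of_le_one_right ha0 hv.le
  · rw [map_smul, norm_smul, Real.norm_of_nonneg ha0, ← haη]
    calc c / 2 * (a * ρ ^ n) = a * (c / 2 * ρ ^ n) := by ring
      _ ≤ a * ‖(D ^ n) v‖ := by gcongr

theorem exists_escape_of_growth {F : E → E} {u : E} {c : ℝ} (hF : HasQuadraticError F D u)
    (hFu : F u = u) (hρ : 1 < ρ) (hD : ∀ n, ‖D ^ n‖ ≤ C * ρ ^ n) (hc : 0 < c)
    (hDc : ∃ᶠ n in atTop, c * ρ ^ n ≤ ‖D ^ n‖) {t : Set E} (ht : t ∈ 𝓝 u) :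
    ∃ ε > 0, ∀ δ > 0, ∃ x, ‖x - u‖ < δ ∧
      ∃ n, (∀ m < n, F^[m] x ∈ t) ∧ ε ≤ ‖F^[n] x - u‖ := by
  have hρ0 : 0 < ρ := one_pos.trans hρ
  obtain ⟨b, hb, hbound⟩ := Asymptotics.IsBigO.exists_nonneg hF
  obtain ⟨R, hR, hball⟩ := Metric.eventually_nhds_iff_ball.1
    (hbound.bound.and (eventually_mem_set.2 ht))
  set K := C * (b * (2 * C) ^ 2) / (ρ - 1) with hK
  have hC : 0 < C := by
    obtain ⟨n, hn⟩ := hDc.exists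
    exact hc.trans_le (le_of_mul_le_mul_right (hn.trans (hD n)) (by positivity))
  obtain ⟨η, hηR, hηC, hηc, hη⟩ : ∃ η : ℝ, 2 * C * η < R ∧ K * η < C ∧ K * η < c / 4 ∧ 0 < η := by
    have hsmall : ∀ k d : ℝ, 0 < d → ∀ᶠ η in 𝓝[>] (0 : ℝ), k * η < d := fun k d hd =>
      nhdsWithin_le_nhds (((continuous_const_mul k).tendsto 0).eventually
        (gt_mem_nhds (by simpa using hd)))
    exact ((hsmall _ _ hR).and ((hsmall _ _ hC).and ((hsmall _ _ (by positivity)).and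
      eventually_mem_nhdsWithin))).exists
  refine ⟨c / 4 * η, by positivity, fun δ hδ => ?_⟩
  obtain ⟨n, a, z, ha, haδ, haη, hza, hz⟩ := exists_small_vector_growing_to hρ hc hDc hη hδ
  have hx : ‖u + z - u‖ ≤ a := by rwa [add_sub_cancel_left]
  have horbit := fun m (hm : m ≤ n) => norm_orbit_sub_pow_apply_le hρ ha hb hD
    (fun x hx => by simpa [hFu] using (hball x hx).1) hx hK hηR hηC.le haη.le hm
  refine ⟨u + z, hx.trans_lt haδ, n, fun m hm => (hball _ (horbit m hm.le).2.2).2, ?_⟩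
  have herror := (horbit n le_rfl).1
  rw [haη, add_sub_cancel_left] at herror
  have htriangle := norm_le_norm_add_norm_sub (F^[n] (u + z) - u) ((D ^ n) z)
  nlinarith

end Escape

section Landweber

variable {H : Type*} [NormedAddCommGroup H] [InnerProductSpace ℝ H] [CompleteSpace H]
  {A D Q T : H →L[ℝ] H} {t : ℝ}

theorem inner_star_mul_self_apply (A : H →L[ℝ] H) (x : H) :
    inner ℝ x ((star A * A) x) = ‖A x‖ ^ 2 := by
  rw [mul_apply_eq_comp, ContinuousLinearMap.star_eq_adjoint,
    ContinuousLinearMap.adjoint_inner_right, real_inner_self_eq_norm_sq]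

theorem opNorm_star_mul_self (A : H →L[ℝ] H) : ‖star A * A‖ = ‖A‖ ^ 2 := by
  rw [sq]; exact A.norm_adjoint_comp_self

theorem norm_star_mul_self_apply_sq_le (A : H →L[ℝ] H) (x : H) :
    ‖(star A * A) x‖ ^ 2 ≤ ‖A‖ ^ 2 * ‖A x‖ ^ 2 := by
  rw [← mul_pow, ← norm_star A]
  exact pow_le_pow_left₀ (norm_nonneg _) ((star A).le_opNorm (A x)) 2

theorem norm_smul_sub_star_mul_self_apply_sq_le (A : H →L[ℝ] H) (x : H) :
    ‖‖A‖ ^ 2 • x - (star A * A) x‖ ^ 2 ≤ ‖A‖ ^ 2 * (‖A‖ ^ 2 * ‖x‖ ^ 2 - ‖A x‖ ^ 2) := by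
  rw [norm_sub_sq_real, inner_smul_left, inner_star_mul_self_apply, norm_smul,
    Real.norm_of_nonneg (sq_nonneg _), conj_trivial]
  linarith [norm_star_mul_self_apply_sq_le A x]

theorem norm_sq_mem_spectrum_star_mul_self (hA : A ≠ 0) :
    ‖A‖ ^ 2 ∈ spectrum ℝ (star A * A) := by
  rw [spectrum.mem_iff]
  rintro ⟨w, hw⟩
  set W : H →L[ℝ] H := ↑w⁻¹
  have hpos : 0 < ‖A‖ ^ 2 := by positivity
  have hbelow (x : H) : ‖x‖ ≤ ‖W‖ * ‖‖A‖ ^ 2 • x - (star A * A) x‖ := by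
    have hWx : W (‖A‖ ^ 2 • x - (star A * A) x) = x := by
      simpa [hw, Algebra.algebraMap_eq_smul_one] using DFunLike.congr_fun w.inv_mul x
    conv_lhs => rw [← hWx]
    exact W.le_opNorm _
  set k : ℝ := ‖W‖ ^ 2 * ‖A‖ ^ 2
  have hdefect (x : H) : ‖x‖ ^ 2 ≤ k * (‖A‖ ^ 2 * ‖x‖ ^ 2 - ‖A x‖ ^ 2) :=
    calc ‖x‖ ^ 2 ≤ ‖W‖ ^ 2 * ‖‖A‖ ^ 2 • x - (star A * A) x‖ ^ 2 := by
          rw [← mul_pow]; exact pow_le_pow_left₀ (norm_nonneg _) (hbelow x) 2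
      _ ≤ ‖W‖ ^ 2 * (‖A‖ ^ 2 * (‖A‖ ^ 2 * ‖x‖ ^ 2 - ‖A x‖ ^ 2)) := by
          gcongr; exact norm_smul_sub_star_mul_self_apply_sq_le A x
      _ = k * (‖A‖ ^ 2 * ‖x‖ ^ 2 - ‖A x‖ ^ 2) := (mul_assoc _ _ _).symm
  have hk : 0 ≤ k := by positivity
  set b : ℝ := k * ‖A‖ ^ 2 * ‖A‖ ^ 2 / (1 + k * ‖A‖ ^ 2)
  have hbound (x : H) : ‖A x‖ ≤ √b * ‖x‖ := by
    have hAx : ‖A x‖ ^ 2 ≤ ‖A‖ ^ 2 * ‖x‖ ^ 2 := by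
      rw [← mul_pow]; exact pow_le_pow_left₀ (norm_nonneg _) (A.le_opNorm x) 2
    rw [← Real.sqrt_sq (norm_nonneg x), ← Real.sqrt_mul (by positivity)]
    refine Real.le_sqrt_of_sq_le ?_
    rw [div_mul_eq_mul_div, le_div_iff₀ (by positivity)]
    nlinarith [mul_le_mul_of_nonneg_left (hdefect x) hpos.le]
  have hnorm : ‖A‖ ^ 2 ≤ b :=
    (Real.le_sqrt' (norm_pos_iff.2 hA)).1 (A.opNorm_le_bound (Real.sqrt_nonneg b) hbound)
  rw [le_div_iff₀ (by positivity)] at hnorm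
  linarith

theorem star_compress (hQ : IsStarProjection Q) : star (Q * T * Q) = Q * star T * Q := by
  rw [star_mul, star_mul, hQ.isSelfAdjoint.star_eq, mul_assoc]

theorem spectrum_neg_mul_star_mul_mul_diff_zero (hQ : IsStarProjection Q) :
    spectrum ℝ (-(Q * star T * Q * T)) \ {0} =
      spectrum ℝ (-(star (Q * T * Q) * (Q * T * Q))) \ {0} := by
  have hQQ : Q * Q = Q := hQ.isIdempotentElem
  have hleft : Q * -(Q * star T * Q * T) = -(Q * star T * Q * T) := by
    simp only [mul_neg, ← mul_assoc, hQQ]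
  have hright : -(Q * star T * Q * T) * Q = -(star (Q * T * Q) * (Q * T * Q)) := by
    rw [star_compress hQ, neg_mul]
    simp only [mul_assoc, ← mul_assoc Q Q, hQQ]
  rw [← hright, ← spectrum.nonzero_mul_comm, hleft]

theorem sInf_spectrum_neg_mul_star_mul_mul (hQ : IsStarProjection Q) :
    sInf (spectrum ℝ (-(Q * star T * Q * T))) = -‖Q * T * Q‖ ^ 2 := by
  have hspec := spectrum_neg_mul_star_mul_mul_diff_zero (T := T) hQ
  set A := Q * T * Q
  have hbound : ∀ l ∈ spectrum ℝ (-(Q * star T * Q * T)), |l| ≤ ‖A‖ ^ 2 := fun l hl => by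
    rcases eq_or_ne l 0 with rfl | hl0
    · simp
    · have hmem : l ∈ spectrum ℝ (-(star A * A)) := (hspec.le ⟨hl, hl0⟩).1
      calc |l| ≤ ‖-(star A * A)‖ * ‖(1 : H →L[ℝ] H)‖ := spectrum.norm_le_norm_mul_of_mem hmem
        _ ≤ ‖-(star A * A)‖ * 1 := by gcongr; exact ContinuousLinearMap.norm_id_le
        _ = ‖A‖ ^ 2 := by rw [norm_neg, mul_one, opNorm_star_mul_self]
  by_cases hA : A = 0
  · have hsub : spectrum ℝ (-(Q * star T * Q * T)) ⊆ {0} := fun l hl => by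
      simpa [hA] using hbound l hl
    rcases Set.subset_singleton_iff_eq.1 hsub with h | h <;> simp [h, hA]
  · refine IsLeast.csInf_eq ⟨(hspec.ge ⟨?_, by simpa using hA⟩).1,
      fun l hl => neg_le_of_abs_le (hbound l hl)⟩
    rw [← spectrum.neg_eq, Set.neg_mem_neg]
    exact norm_sq_mem_spectrum_star_mul_self hA

theorem exists_norm_le_mul_norm_apply_of_isClosed_range (hA : IsClosed (range A)) :
    ∃ k > 0, ∀ y ∈ A.kerᗮ, ‖y‖ ≤ k * ‖A y‖ := by
  set f : A.kerᗮ →L[ℝ] H := A.comp A.kerᗮ.subtypeL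
  have hinj : Function.Injective f := by
    rw [injective_iff_map_eq_zero]
    exact fun y hy => Subtype.ext (A.ker.disjoint_def.1 A.ker.orthogonal_disjoint _ hy y.2)
  have hrange : range f = range A := by
    refine (range_comp_subset_range _ A).antisymm ?_
    rintro _ ⟨x, rfl⟩
    refine ⟨⟨x - A.ker.starProjection x, A.ker.sub_starProjection_mem_orthogonal x⟩, ?_⟩
    have hzero : A (A.ker.starProjection x) = 0 := A.ker.starProjection_apply_mem x
    simp [hzero]
  obtain ⟨k, hk⟩ := f.antilipschitz_of_injective_of_isClosed_range hinj (hrange ▸ hA)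
  refine ⟨k + 1, by positivity, fun y hy => ?_⟩
  have hle : ‖y‖ ≤ k * ‖A y‖ := by simpa [f] using hk.le_mul_dist ⟨y, hy⟩ 0
  linarith [norm_nonneg (A y)]

theorem norm_one_sub_smul_star_mul_self_apply_sq_le (A : H →L[ℝ] H) (t : ℝ) (x : H) :
    ‖(1 - t • (star A * A)) x‖ ^ 2 ≤ ‖x‖ ^ 2 - t * (2 - t * ‖A‖ ^ 2) * ‖A x‖ ^ 2 := by
  have heq : ‖(1 - t • (star A * A)) x‖ ^ 2 =
      ‖x‖ ^ 2 - 2 * t * ‖A x‖ ^ 2 + t ^ 2 * ‖(star A * A) x‖ ^ 2 := by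
    rw [sub_apply, one_apply_eq_self, smul_apply, norm_sub_sq_real, inner_smul_right,
      inner_star_mul_self_apply, norm_smul, mul_pow, Real.norm_eq_abs, sq_abs]
    ring
  nlinarith [mul_le_mul_of_nonneg_left (norm_star_mul_self_apply_sq_le A x) (sq_nonneg t)]

theorem exists_norm_one_sub_smul_star_mul_self_apply_le (hA : IsClosed (range A)) (ht : 0 < t)
    (htA : t * ‖A‖ ^ 2 < 2) : ∃ θ, 0 ≤ θ ∧ θ < 1 ∧
      ∀ y ∈ A.kerᗮ, ‖(1 - t • (star A * A)) y‖ ≤ θ * ‖y‖ := by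
  obtain ⟨k, hk, hle⟩ := exists_norm_le_mul_norm_apply_of_isClosed_range hA
  set a : ℝ := t * (2 - t * ‖A‖ ^ 2) / k ^ 2
  have ha : 0 < a := div_pos (mul_pos ht (sub_pos.2 htA)) (pow_pos hk 2)
  refine ⟨√(1 - a), Real.sqrt_nonneg _, (Real.sqrt_lt' one_pos).2 (by linarith),
    fun y hy => ?_⟩
  rw [← Real.sqrt_sq (norm_nonneg y), ← Real.sqrt_mul' _ (sq_nonneg _)]
  refine Real.le_sqrt_of_sq_le ((norm_one_sub_smul_star_mul_self_apply_sq_le A t y).trans ?_)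
  have hsq : a * ‖y‖ ^ 2 ≤ t * (2 - t * ‖A‖ ^ 2) * ‖A y‖ ^ 2 := by
    rw [div_mul_eq_mul_div, div_le_iff₀ (pow_pos hk 2), mul_assoc _ (‖A y‖ ^ 2), ← mul_pow,
      mul_comm _ k]
    have hcoef : 0 ≤ t * (2 - t * ‖A‖ ^ 2) := (mul_pos ht (sub_pos.2 htA)).le
    gcongr
    exact hle y hy
  linarith

theorem star_apply_mem_orthogonal_ker (A : H →L[ℝ] H) (z : H) : star A z ∈ A.kerᗮ := by
  intro y hy
  rw [ContinuousLinearMap.star_eq_adjoint, ContinuousLinearMap.adjoint_inner_right,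
    show A y = 0 from hy, inner_zero_left]

theorem mul_starProjection_ker (A : H →L[ℝ] H) : A * A.ker.starProjection = 0 :=
  ContinuousLinearMap.ext fun x => A.ker.starProjection_apply_mem x

theorem tendsto_one_sub_smul_star_mul_self_pow (hA : IsClosed (range A)) (ht : 0 < t)
    (htA : t * ‖A‖ ^ 2 < 2) :
    Tendsto (fun n => (1 - t • (star A * A)) ^ n) atTop (𝓝 A.ker.starProjection) := by
  obtain ⟨θ, hθ0, hθ1, hθ⟩ := exists_norm_one_sub_smul_star_mul_self_apply_le hA ht htA
  set P := A.ker.starProjection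
  set L := 1 - t • (star A * A)
  have hinv (y : H) (hy : y ∈ A.kerᗮ) : L y ∈ A.kerᗮ :=
    Submodule.sub_mem _ hy (Submodule.smul_mem _ t (star_apply_mem_orthogonal_ker A (A y)))
  have hdecay (n : ℕ) (y : H) (hy : y ∈ A.kerᗮ) :
      (L ^ n) y ∈ A.kerᗮ ∧ ‖(L ^ n) y‖ ≤ θ ^ n * ‖y‖ := by
    induction n with
    | zero => simpa using hy
    | succ n ih =>
      rw [pow_succ', mul_apply_eq_comp]
      refine ⟨hinv _ ih.1, (hθ _ ih.1).trans ?_⟩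
      rw [pow_succ', mul_assoc]
      exact mul_le_mul_of_nonneg_left ih.2 hθ0
  have hLP : L * P = P := by simp [L, sub_mul, mul_assoc, P, mul_starProjection_ker A]
  have hpow (n : ℕ) : L ^ n * P = P := by
    induction n with
    | zero => exact one_mul P
    | succ n ih => rw [pow_succ, mul_assoc, hLP, ih]
  refine tendsto_iff_norm_sub_tendsto_zero.2 (squeeze_zero (fun _ => norm_nonneg _) (fun n => ?_)
    (tendsto_pow_atTop_nhds_zero_of_lt_one hθ0 hθ1))
  refine ContinuousLinearMap.opNorm_le_bound _ (pow_nonneg hθ0 n) fun x => ?_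
  have hsplit : (L ^ n - P) x = (L ^ n) (x - P x) := by
    rw [map_sub, ← mul_apply_eq_comp, hpow, sub_apply]
  have hle : ‖x - P x‖ ≤ ‖x‖ := by
    rw [← A.ker.starProjection_orthogonal_val]
    exact A.kerᗮ.norm_starProjection_apply_le x
  rw [hsplit]
  refine (hdecay n _ (A.ker.sub_starProjection_mem_orthogonal x)).2.trans ?_
  gcongr

theorem pow_succ_eq_pow_mul_of_mul_self_eq {R : Type*} [Monoid R] {a b : R}
    (h : a * a = b * a) (n : ℕ) : a ^ (n + 1) = b ^ n * a := by
  induction n with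
  | zero => simp
  | succ n ih => rw [pow_succ, ih, mul_assoc, h, ← mul_assoc, pow_succ]

theorem exists_tendsto_pow_of_mul_eq_sub_smul (hQD : Q * D = D)
    (hDQ : D * Q = Q - t • (star A * A)) (hA : IsClosed (range A)) (ht : 0 < t)
    (htA : t * ‖A‖ ^ 2 < 2) :
    ∃ P : H →L[ℝ] H, Tendsto (fun n => D ^ n) atTop (𝓝 P) ∧ A * P = 0 ∧ Q * P = P := by
  have hsq : D * D = (1 - t • (star A * A)) * D :=
    calc D * D = D * Q * D := by rw [mul_assoc, hQD]
      _ = (1 - t • (star A * A)) * D := by rw [hDQ, sub_mul, hQD, sub_mul, one_mul]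
  have hlim : Tendsto (fun n => D ^ (n + 1)) atTop (𝓝 (A.ker.starProjection * D)) := by
    simp only [pow_succ_eq_pow_mul_of_mul_self_eq hsq]
    exact (tendsto_one_sub_smul_star_mul_self_pow hA ht htA).mul_const D
  refine ⟨_, (tendsto_add_atTop_iff_nat 1).1 hlim, ?_, ?_⟩
  · rw [← mul_assoc, mul_starProjection_ker, zero_mul]
  · refine tendsto_nhds_unique (hlim.const_mul Q) (hlim.congr fun n => ?_)
    rw [pow_succ', ← mul_assoc, hQD]

theorem one_lt_norm_sub_smul_star_mul_self (hQ : ‖Q‖ ≤ 1) (ht : 0 < t)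
    (htA : 2 < t * ‖A‖ ^ 2) : 1 < ‖Q - t • (star A * A)‖ := by
  have hnorm : ‖t • (star A * A)‖ = t * ‖A‖ ^ 2 := by
    rw [norm_smul, Real.norm_of_nonneg ht.le, opNorm_star_mul_self]
  have hle := norm_sub_norm_le (t • (star A * A)) Q
  rw [norm_sub_rev] at hle
  linarith

theorem exists_pow_growth_of_mul_eq_sub_smul (hQ : IsStarProjection Q) (hQD : Q * D = D)
    (hDQ : D * Q = Q - t • (star A * A)) (ht : 0 < t) (htA : 2 < t * ‖A‖ ^ 2) :
    ∃ ρ > 1, (∃ C, ∀ n, ‖D ^ n‖ ≤ C * ρ ^ n) ∧ ∃ᶠ n in atTop, ρ ^ n ≤ ‖D ^ n‖ := by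
  set G := D * Q with hG
  have hGself : IsSelfAdjoint G := by
    rw [hDQ]
    exact hQ.isSelfAdjoint.sub (IsSelfAdjoint.smul (.all t) (.star_mul_self A))
  have hQ1 : ‖Q‖ ≤ 1 := IsStarProjection.norm_le Q hQ
  have hρ : 1 < ‖G‖ := hDQ ▸ one_lt_norm_sub_smul_star_mul_self hQ1 ht htA
  have hpow (n : ℕ) : D ^ (n + 1) = G ^ n * D :=
    pow_succ_eq_pow_mul_of_mul_self_eq (by rw [hG, mul_assoc, hQD]) n
  have hpowQ (n : ℕ) : D ^ (n + 1) * Q = G ^ (n + 1) := by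
    rw [hpow, mul_assoc, ← hG, pow_succ]
  have : Nontrivial H := (subsingleton_or_nontrivial H).resolve_left fun _ =>
    absurd hρ (by simp [Subsingleton.elim G 0])
  refine ⟨‖G‖, hρ, ⟨1 + ‖D‖, fun n => ?_⟩, ?_⟩
  · cases n with
    | zero => simp
    | succ n =>
      calc ‖D ^ (n + 1)‖ ≤ ‖G‖ ^ n * ‖D‖ := by
            rw [hpow]
            refine (norm_mul_le _ _).trans ?_
            gcongr
            exact norm_pow_le G n
        _ ≤ ‖G‖ ^ (n + 1) * (1 + ‖D‖) := by
            gcongr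
            · exact hρ.le
            · exact n.le_succ
            · linarith
        _ = _ := mul_comm _ _
  · refine frequently_atTop.2 fun N => ⟨2 ^ N, N.lt_two_pow_self.le, ?_⟩
    obtain ⟨n, hn⟩ := Nat.exists_eq_add_one_of_ne_zero (pow_ne_zero N two_ne_zero)
    have hGnorm : ‖G ^ 2 ^ N‖ = ‖G‖ ^ 2 ^ N := hGself.norm_pow_two_pow N
    calc ‖G‖ ^ 2 ^ N = ‖D ^ 2 ^ N * Q‖ := by rw [← hGnorm, hn, hpowQ]
      _ ≤ ‖D ^ 2 ^ N‖ * ‖Q‖ := norm_mul_le _ _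
      _ ≤ ‖D ^ 2 ^ N‖ := mul_le_of_le_one_right (norm_nonneg _) hQ1

end Landweber

section Thresholds

variable {a t : ℝ}

theorem mul_lt_two_of_ofReal_lt_dtMax (ht : 0 < t) (h : ENNReal.ofReal t < dtMax (-a)) :
    t * a < 2 := by
  rcases le_or_gt a 0 with ha | ha
  · linarith [mul_nonpos_of_nonneg_of_nonpos ht.le ha]
  · rw [dtMax, neg_neg, ENNReal.lt_div_iff_mul_lt (.inl (by simpa using ha))
      (.inl ENNReal.ofReal_ne_top), ← ENNReal.ofReal_mul ht.le, ← ENNReal.ofReal_ofNat 2] at h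
    exact (ENNReal.ofReal_lt_ofReal_iff two_pos).1 h

theorem two_lt_mul_of_dtMax_lt_ofReal (ht : 0 < t) (h : dtMax (-a) < ENNReal.ofReal t) :
    2 < t * a := by
  rcases le_or_gt a 0 with ha | ha
  · simp [dtMax, ENNReal.ofReal_of_nonpos ha, ENNReal.div_zero two_ne_zero] at h
  · rw [dtMax, neg_neg, ENNReal.div_lt_iff (.inl (by simpa using ha))
      (.inl ENNReal.ofReal_ne_top), ← ENNReal.ofReal_mul ht.le, ← ENNReal.ofReal_ofNat 2] at h
    exact (ENNReal.ofReal_lt_ofReal_iff (mul_pos ht ha)).1 h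

end Thresholds

section Conjugation

theorem exists_norm_conjContinuousAlgEquiv_le {E F : Type*} [NormedAddCommGroup E]
    [NormedSpace ℝ E] [NormedAddCommGroup F] [NormedSpace ℝ F] (e : E ≃L[ℝ] F) :
    ∃ k > 0, ∀ T : E →L[ℝ] E, ‖e.conjContinuousAlgEquiv T‖ ≤ k * ‖T‖ := by
  refine ⟨‖(e : E →L[ℝ] F)‖ * ‖(e.symm : F →L[ℝ] E)‖ + 1, by positivity, fun T => ?_⟩
  calc ‖e.conjContinuousAlgEquiv T‖
      ≤ ‖(e : E →L[ℝ] F)‖ * (‖T‖ * ‖(e.symm : F →L[ℝ] E)‖) :=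
        (ContinuousLinearMap.opNorm_comp_le _ _).trans
          (mul_le_mul_of_nonneg_left (ContinuousLinearMap.opNorm_comp_le _ _) (norm_nonneg _))
    _ ≤ _ := by nlinarith [norm_nonneg T]

end Conjugation

section EnergySpace

variable {E : Type*} [NormedAddCommGroup E] [NormedSpace ℝ E] {M : E ≃L[ℝ] (E →L[ℝ] ℝ)}

/-- A topological isomorphism of `E` onto its dual which, read as the bilinear form
`(v, w) ↦ M v w`, is symmetric and positive definite. -/
structure IsHermitianPosDef (M : E ≃L[ℝ] (E →L[ℝ] ℝ)) : Prop where
  symm : ∀ v w, M v w = M w v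
  pos : ∀ v, v ≠ 0 → 0 < M v v

/-- The energy space of `M`: the vector space `E` with the inner product `⟪v, w⟫ = M v w`. It is a
type synonym because its norm is only equivalent to that of `E`. -/
def EnergySpace (_hM : IsHermitianPosDef M) : Type _ := E

namespace EnergySpace

variable (hM : IsHermitianPosDef M)

instance : AddCommGroup (EnergySpace hM) := inferInstanceAs (AddCommGroup E)

instance : Module ℝ (EnergySpace hM) := inferInstanceAs (Module ℝ E)

/-- The inner product `⟪v, w⟫ = M v w` on the energy space. -/
abbrev core : InnerProductSpace.Core ℝ (EnergySpace hM) where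
  inner v w := (M : E → E →L[ℝ] ℝ) v w
  conj_inner_symm v w := hM.symm w v
  re_inner_nonneg v := by
    rcases eq_or_ne v 0 with rfl | hv
    · exact (DFunLike.congr_fun M.map_zero (0 : E)).ge
    · exact (hM.pos v hv).le
  add_left v w z := DFunLike.congr_fun (M.map_add (v : E) (w : E)) (z : E)
  smul_left v w a := DFunLike.congr_fun (M.map_smul a (v : E)) (w : E)
  definite v hv := by_contra fun hne => (hM.pos v hne).ne' hv

instance : NormedAddCommGroup (EnergySpace hM) := (core hM).toNormedAddCommGroup

instance : InnerProductSpace ℝ (EnergySpace hM) := .ofCore (core hM).toCore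

end EnergySpace

namespace IsHermitianPosDef

/-- The identity map from `E` to the energy space of `M`, as a linear equivalence. -/
def linearEquiv (hM : IsHermitianPosDef M) : E ≃ₗ[ℝ] EnergySpace hM := LinearEquiv.refl ℝ E

theorem inner_linearEquiv (hM : IsHermitianPosDef M) (v w : E) :
    inner ℝ (hM.linearEquiv v) (hM.linearEquiv w) = M v w := rfl

theorem norm_linearEquiv_le (hM : IsHermitianPosDef M) (v : E) :
    ‖hM.linearEquiv v‖ ≤ √‖(M : E →L[ℝ] (E →L[ℝ] ℝ))‖ * ‖v‖ := by
  rw [← Real.sqrt_sq (norm_nonneg v), ← Real.sqrt_mul' _ (sq_nonneg _)]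
  refine Real.le_sqrt_of_sq_le ?_
  rw [← real_inner_self_eq_norm_sq, hM.inner_linearEquiv, sq, ← mul_assoc]
  exact (le_abs_self _).trans ((M : E →L[ℝ] (E →L[ℝ] ℝ)).le_opNorm₂ v v)

theorem norm_apply_le (hM : IsHermitianPosDef M) (v : E) :
    ‖M v‖ ≤ √‖(M : E →L[ℝ] (E →L[ℝ] ℝ))‖ * ‖hM.linearEquiv v‖ := by
  refine ContinuousLinearMap.opNorm_le_bound _ (by positivity) fun w => ?_
  calc ‖M v w‖ ≤ ‖hM.linearEquiv v‖ * ‖hM.linearEquiv w‖ := by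
        rw [← hM.inner_linearEquiv]; exact norm_inner_le_norm _ _
    _ ≤ ‖hM.linearEquiv v‖ * (√‖(M : E →L[ℝ] (E →L[ℝ] ℝ))‖ * ‖w‖) := by
        gcongr; exact hM.norm_linearEquiv_le w
    _ = √‖(M : E →L[ℝ] (E →L[ℝ] ℝ))‖ * ‖hM.linearEquiv v‖ * ‖w‖ := by ring

theorem norm_linearEquiv_symm_le (hM : IsHermitianPosDef M) (x : EnergySpace hM) :
    ‖hM.linearEquiv.symm x‖ ≤ ‖(M.symm : (E →L[ℝ] ℝ) →L[ℝ] E)‖ *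
      √‖(M : E →L[ℝ] (E →L[ℝ] ℝ))‖ * ‖x‖ := by
  obtain ⟨v, rfl⟩ := hM.linearEquiv.surjective x
  rw [LinearEquiv.symm_apply_apply, mul_assoc]
  calc ‖v‖ = ‖(M.symm : (E →L[ℝ] ℝ) →L[ℝ] E) (M v)‖ := by simp
    _ ≤ ‖(M.symm : (E →L[ℝ] ℝ) →L[ℝ] E)‖ * ‖M v‖ := ContinuousLinearMap.le_opNorm _ _
    _ ≤ _ := by gcongr; exact hM.norm_apply_le v

/-- The identity map from `E` to the energy space of `M`, as a topological isomorphism. -/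
def equiv (hM : IsHermitianPosDef M) : E ≃L[ℝ] EnergySpace hM where
  toLinearEquiv := hM.linearEquiv
  continuous_toFun := AddMonoidHomClass.continuous_of_bound hM.linearEquiv _ hM.norm_linearEquiv_le
  continuous_invFun :=
    AddMonoidHomClass.continuous_of_bound hM.linearEquiv.symm _ hM.norm_linearEquiv_symm_le

theorem inner_equiv (hM : IsHermitianPosDef M) (v w : E) :
    inner ℝ (hM.equiv v) (hM.equiv w) = M v w := rfl

instance [CompleteSpace E] (hM : IsHermitianPosDef M) : CompleteSpace (EnergySpace hM) :=
  (completeSpace_congr (e := hM.equiv.toEquiv) hM.equiv.isUniformEmbedding).1 ‹_›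

theorem isClosed_range_conj_iff (hM : IsHermitianPosDef M) (T : E →L[ℝ] E) :
    IsClosed (range (hM.equiv.conjContinuousAlgEquiv T)) ↔ IsClosed (range T) := by
  have hrange : range (hM.equiv.conjContinuousAlgEquiv T) = hM.equiv '' range T := by
    rw [← range_comp, ← hM.equiv.symm.surjective.range_comp (hM.equiv ∘ T)]
    rfl
  rw [hrange, hM.equiv.isClosed_image]

variable [CompleteSpace E] {D Q S T : E →L[ℝ] E} {t : ℝ}

theorem star_conj_eq (hM : IsHermitianPosDef M) (hS : ∀ v w, M (S v) w = M v (T w)) :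
    star (hM.equiv.conjContinuousAlgEquiv T) = hM.equiv.conjContinuousAlgEquiv S := by
  refine ((ContinuousLinearMap.eq_adjoint_iff _ _).2 fun x y => ?_).symm
  obtain ⟨v, rfl⟩ := hM.equiv.surjective x
  obtain ⟨w, rfl⟩ := hM.equiv.surjective y
  simp only [ContinuousLinearEquiv.conjContinuousAlgEquiv_apply_apply,
    ContinuousLinearEquiv.symm_apply_apply, hM.inner_equiv, hS]

theorem isStarProjection_conj (hM : IsHermitianPosDef M) (hQQ : Q * Q = Q)
    (hQ : ∀ v w, M (Q v) w = M v (Q w)) :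
    IsStarProjection (hM.equiv.conjContinuousAlgEquiv Q) where
  isIdempotentElem := by rw [IsIdempotentElem, ← map_mul, hQQ]
  isSelfAdjoint := hM.star_conj_eq hQ

theorem lambdaMin_neg_mul (hM : IsHermitianPosDef M) (hQQ : Q * Q = Q)
    (hQ : ∀ v w, M (Q v) w = M v (Q w)) (hS : ∀ v w, M (S v) w = M v (T w)) :
    lambdaMin (-(Q * S * Q * T)) = -‖hM.equiv.conjContinuousAlgEquiv (Q * T * Q)‖ ^ 2 := by
  rw [lambdaMin, ← AlgEquiv.spectrum_eq hM.equiv.conjContinuousAlgEquiv]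
  simpa only [map_neg, map_mul, hM.star_conj_eq hS] using
    sInf_spectrum_neg_mul_star_mul_mul (T := hM.equiv.conjContinuousAlgEquiv T)
      (hM.isStarProjection_conj hQQ hQ)

theorem conj_mul_conj_eq_sub_smul (hM : IsHermitianPosDef M) (hQQ : Q * Q = Q)
    (hQ : ∀ v w, M (Q v) w = M v (Q w)) (hS : ∀ v w, M (S v) w = M v (T w))
    (hDQ : D * Q = Q + t • (-(Q * S * Q * T) * Q)) :
    hM.equiv.conjContinuousAlgEquiv D * hM.equiv.conjContinuousAlgEquiv Q =
      hM.equiv.conjContinuousAlgEquiv Q -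
        t • (star (hM.equiv.conjContinuousAlgEquiv (Q * T * Q)) *
          hM.equiv.conjContinuousAlgEquiv (Q * T * Q)) := by
  have hadj (v w : E) : M ((Q * S * Q) v) w = M v ((Q * T * Q) w) := by
    simp only [mul_apply_eq_comp, hQ, hS]
  have hmul : D * Q = Q - t • (Q * S * Q * (Q * T * Q)) := by
    rw [hDQ, neg_mul, smul_neg, ← sub_eq_add_neg]
    simp only [mul_assoc, ← mul_assoc Q Q, hQQ]
  rw [hM.star_conj_eq hadj, ← map_mul, ← map_mul, hmul, map_sub]
  exact congrArg _ (hM.equiv.conjContinuousAlgEquiv.toContinuousLinearEquiv.map_smul t _)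

theorem exists_tendsto_pow_of_lt_dtMax (hM : IsHermitianPosDef M) (hQQ : Q * Q = Q)
    (hQ : ∀ v w, M (Q v) w = M v (Q w)) (hS : ∀ v w, M (S v) w = M v (T w)) (hQD : Q * D = D)
    (hDQ : D * Q = Q + t • (-(Q * S * Q * T) * Q)) (hrange : IsClosed (range (Q * T * Q)))
    (ht : 0 < t) (hlt : ENNReal.ofReal t < dtMax (lambdaMin (-(Q * S * Q * T)))) :
    ∃ P : E →L[ℝ] E, Tendsto (fun n => D ^ n) atTop (𝓝 P) ∧ Q * T * Q * P = 0 ∧ Q * P = P := by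
  set Φ := hM.equiv.conjContinuousAlgEquiv
  rw [hM.lambdaMin_neg_mul hQQ hQ hS] at hlt
  have hΦQD : Φ Q * Φ D = Φ D := by rw [← map_mul, hQD]
  have hΦDQ : Φ D * Φ Q = Φ Q - t • (star (Φ (Q * T * Q)) * Φ (Q * T * Q)) :=
    hM.conj_mul_conj_eq_sub_smul hQQ hQ hS hDQ
  obtain ⟨P, hP, hAP, hQP⟩ := exists_tendsto_pow_of_mul_eq_sub_smul hΦQD hΦDQ
    ((hM.isClosed_range_conj_iff _).2 hrange) ht (mul_lt_two_of_ofReal_lt_dtMax ht hlt)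
  have hpow : (fun n => Φ.symm (Φ D ^ n)) = fun n => D ^ n := by
    simp only [← map_pow, Φ.symm_apply_apply]
  refine ⟨Φ.symm P, hpow ▸ (Φ.symm.continuous.tendsto P).comp hP, ?_, ?_⟩
  · simpa only [map_mul, map_zero, Φ.symm_apply_apply] using congrArg Φ.symm hAP
  · simpa only [map_mul, Φ.symm_apply_apply] using congrArg Φ.symm hQP

theorem exists_pow_growth_of_dtMax_lt (hM : IsHermitianPosDef M) (hQQ : Q * Q = Q)
    (hQ : ∀ v w, M (Q v) w = M v (Q w)) (hS : ∀ v w, M (S v) w = M v (T w)) (hQD : Q * D = D)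
    (hDQ : D * Q = Q + t • (-(Q * S * Q * T) * Q)) (ht : 0 < t)
    (hlt : dtMax (lambdaMin (-(Q * S * Q * T))) < ENNReal.ofReal t) :
    ∃ ρ > 1, (∃ C, ∀ n, ‖D ^ n‖ ≤ C * ρ ^ n) ∧ ∃ c > 0, ∃ᶠ n in atTop, c * ρ ^ n ≤ ‖D ^ n‖ := by
  set Φ := hM.equiv.conjContinuousAlgEquiv
  rw [hM.lambdaMin_neg_mul hQQ hQ hS] at hlt
  have hΦQD : Φ Q * Φ D = Φ D := by rw [← map_mul, hQD]
  have hΦDQ : Φ D * Φ Q = Φ Q - t • (star (Φ (Q * T * Q)) * Φ (Q * T * Q)) :=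
    hM.conj_mul_conj_eq_sub_smul hQQ hQ hS hDQ
  obtain ⟨ρ, hρ, ⟨C, hC⟩, hfreq⟩ := exists_pow_growth_of_mul_eq_sub_smul
    (hM.isStarProjection_conj hQQ hQ) hΦQD hΦDQ ht (two_lt_mul_of_dtMax_lt_ofReal ht hlt)
  obtain ⟨k, hk, hΦ⟩ := exists_norm_conjContinuousAlgEquiv_le hM.equiv
  obtain ⟨l, hl, hΦsymm⟩ := exists_norm_conjContinuousAlgEquiv_le hM.equiv.symm
  refine ⟨ρ, hρ, ⟨l * C, fun n => ?_⟩, k⁻¹, inv_pos.2 hk, hfreq.mono fun n hn => ?_⟩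
  · calc ‖D ^ n‖ = ‖Φ.symm (Φ (D ^ n))‖ := by rw [Φ.symm_apply_apply]
      _ ≤ l * ‖Φ (D ^ n)‖ := hΦsymm _
      _ ≤ l * (C * ρ ^ n) := by rw [map_pow]; gcongr; exact hC n
      _ = l * C * ρ ^ n := by ring
  · rw [inv_mul_le_iff₀ hk]
    calc ρ ^ n ≤ ‖Φ (D ^ n)‖ := by rwa [map_pow]
      _ ≤ k * ‖D ^ n‖ := hΦ _

end IsHermitianPosDef

end EnergySpace

section Projection

variable {N r K : ℕ} {X : Fin K → Type*} [∀ k, NormedAddCommGroup (X k)]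
  [∀ k, NormedSpace ℝ (X k)] {M : (∀ k, X k) ≃L[ℝ] ((∀ k, X k) →L[ℝ] ℝ)}
  {B : Fin r → ((∀ k, X k) →L[ℝ] ℝ)}

theorem gram_det_ne_zero (hM : IsHermitianPosDef M) (hB : LinearIndependent ℝ B) :
    (gram M B).det ≠ 0 := by
  intro hdet
  obtain ⟨a, ha, hker⟩ := Matrix.exists_mulVec_eq_zero_iff.2 hdet
  set F := ∑ j, a j • B j with hF
  have hF0 : F ≠ 0 := fun h => ha (funext (Fintype.linearIndependent_iff.1 hB a h))
  have hBF (i : Fin r) : B i (M.symm F) = 0 := by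
    simpa [Matrix.mulVec, dotProduct, gram, hF, mul_comm] using congrFun hker i
  refine (hM.pos (M.symm F) (by simpa using hF0)).ne' ?_
  have hFv (v : ∀ k, X k) : F v = ∑ j, a j * B j v := by simp [hF]
  simp only [M.apply_symm_apply, hFv, hBF, mul_zero, Finset.sum_const_zero]

theorem coef_eq_mulVec (F : (∀ k, X k) →L[ℝ] ℝ) :
    (fun j => coef M B j F) = (gram M B)⁻¹.mulVec fun i => B i (M.symm F) := by
  ext j
  simp [coef, Matrix.mulVec, dotProduct]

theorem projB_apply (F : (∀ k, X k) →L[ℝ] ℝ) : projB M B F = ∑ j, coef M B j F • B j := by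
  simp [projB]

theorem apply_symm_sum_smul (a : Fin r → ℝ) :
    (fun i => B i (M.symm (∑ j, a j • B j))) = (gram M B).mulVec a := by
  ext i
  simp [Matrix.mulVec, dotProduct, gram, mul_comm]

theorem coef_sum_smul (hdet : (gram M B).det ≠ 0) (a : Fin r → ℝ) :
    (fun j => coef M B j (∑ i, a i • B i)) = a := by
  rw [coef_eq_mulVec, apply_symm_sum_smul, Matrix.mulVec_mulVec,
    Matrix.nonsing_inv_mul _ hdet.isUnit, Matrix.one_mulVec]

theorem projB_sum_smul (hdet : (gram M B).det ≠ 0) (a : Fin r → ℝ) :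
    projB M B (∑ i, a i • B i) = ∑ i, a i • B i := by
  rw [projB_apply]
  exact Finset.sum_congr rfl fun j _ => congrArg (· • B j) (congrFun (coef_sum_smul hdet a) j)

theorem apply_symm_projB (hdet : (gram M B).det ≠ 0) (F : (∀ k, X k) →L[ℝ] ℝ) (i : Fin r) :
    B i (M.symm (projB M B F)) = B i (M.symm F) := by
  suffices h : (fun i => B i (M.symm (projB M B F))) = fun i => B i (M.symm F) from congrFun h i
  rw [projB_apply, apply_symm_sum_smul, coef_eq_mulVec, Matrix.mulVec_mulVec,
    Matrix.mul_nonsing_inv _ hdet.isUnit, Matrix.one_mulVec]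

variable (M B) in
/-- The projection `1 - M⁻¹ B ⟨B, M⁻¹B⟩⁻¹ ⟨B, ·⟩` of `∀ k, X k` onto the common kernel of the
functionals `B_j`, orthogonal for the energy inner product of `M`. -/
def kerProj : (∀ k, X k) →L[ℝ] (∀ k, X k) :=
  1 - (M.symm : ((∀ k, X k) →L[ℝ] ℝ) →L[ℝ] (∀ k, X k)).comp
    ((projB M B).comp (M : (∀ k, X k) →L[ℝ] ((∀ k, X k) →L[ℝ] ℝ)))

theorem kerProj_symm_apply (F : (∀ k, X k) →L[ℝ] ℝ) :
    kerProj M B (M.symm F) = M.symm (F - projB M B F) := by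
  simp [kerProj]

theorem apply_kerProj (hdet : (gram M B).det ≠ 0) (j : Fin r) (v : ∀ k, X k) :
    B j (kerProj M B v) = 0 := by
  obtain ⟨F, rfl⟩ := M.symm.surjective v
  rw [kerProj_symm_apply, map_sub, map_sub, apply_symm_projB hdet, sub_self]

theorem kerProj_eq_self_iff (hdet : (gram M B).det ≠ 0) {v : ∀ k, X k} :
    kerProj M B v = v ↔ ∀ j, B j v = 0 := by
  refine ⟨fun h j => h ▸ apply_kerProj hdet j v, fun h => ?_⟩
  obtain ⟨F, rfl⟩ := M.symm.surjective v
  have hcoef : (fun j => coef M B j F) = 0 := by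
    rw [coef_eq_mulVec, show (fun i => B i (M.symm F)) = 0 from funext h, Matrix.mulVec_zero]
  rw [kerProj_symm_apply, projB_apply,
    Finset.sum_eq_zero fun j _ => by rw [congrFun hcoef j, Pi.zero_apply, zero_smul], sub_zero]

theorem kerProj_symm_sum_smul (hdet : (gram M B).det ≠ 0) (a : Fin r → ℝ) :
    kerProj M B (M.symm (∑ j, a j • B j)) = 0 := by
  rw [kerProj_symm_apply, projB_sum_smul hdet, sub_self, map_zero]

theorem kerProj_mul_eq_self (hdet : (gram M B).det ≠ 0) {D : (∀ k, X k) →L[ℝ] (∀ k, X k)}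
    (hD : ∀ j v, B j (D v) = 0) : kerProj M B * D = D :=
  ContinuousLinearMap.ext fun v => (kerProj_eq_self_iff hdet).2 fun j => hD j v

theorem kerProj_mul_self (hdet : (gram M B).det ≠ 0) :
    kerProj M B * kerProj M B = kerProj M B :=
  kerProj_mul_eq_self hdet (apply_kerProj hdet)

theorem apply_kerProj_comm (hM : IsHermitianPosDef M) (hdet : (gram M B).det ≠ 0)
    (v w : ∀ k, X k) : M (kerProj M B v) w = M v (kerProj M B w) := by
  have horth (v w : ∀ k, X k) : M (kerProj M B v) w = M (kerProj M B v) (kerProj M B w) := by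
    obtain ⟨F, rfl⟩ := M.symm.surjective w
    rw [kerProj_symm_apply, map_sub M.symm, map_sub, hM.symm _ (M.symm (projB M B F)),
      M.apply_symm_apply, projB_apply]
    simp [apply_kerProj hdet]
  rw [horth, hM.symm v, horth w, hM.symm]

variable {L : (∀ k, X k) →L[ℝ] (∀ k, X k) →L[ℝ] ℝ}

theorem apply_symm_comp_flip (hM : IsHermitianPosDef M) (v w : ∀ k, X k) :
    M ((M.symm : ((∀ k, X k) →L[ℝ] ℝ) →L[ℝ] (∀ k, X k)).comp L.flip v) w =
      M v ((M.symm : ((∀ k, X k) →L[ℝ] ℝ) →L[ℝ] (∀ k, X k)).comp L w) := by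
  rw [hM.symm v]
  simp

theorem LPCG_eq (ι : ∀ k, X k →L[ℝ] L2 N) (q : Matrix (Fin r) (Fin K) ℝ)
    (L00 : (∀ k, X k) → ((∀ k, X k) →L[ℝ] ℝ)) (μ : Fin r → ℝ) (u : ∀ k, X k) :
    LPCG ι q L00 M μ u = -(kerProj M (colB ι q u) *
      (M.symm : ((∀ k, X k) →L[ℝ] ℝ) →L[ℝ] (∀ k, X k)).comp (L1 ι q L00 μ u).flip *
      kerProj M (colB ι q u) *
      (M.symm : ((∀ k, X k) →L[ℝ] ℝ) →L[ℝ] (∀ k, X k)).comp (L1 ι q L00 μ u)) := by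
  ext1 v
  simp only [LPCG, LhatPCG, mul_apply_eq_comp, ContinuousLinearMap.comp_apply, neg_apply,
    ContinuousLinearEquiv.coe_coe, kerProj_symm_apply, sub_apply, map_neg]
  rw [neg_sub_neg, ← map_neg, neg_sub]

section Family

variable {Z : (Fin r → ℝ) → ∀ k, X k} {S : (Fin r → ℝ) ≃L[ℝ] (Fin r → ℝ)}

theorem range_kerProj_mul_mul_kerProj (hdet : (gram M B).det ≠ 0)
    (hLZ : ∀ a, L (Z a) = ∑ j, a j • B j) (hS : ∀ a j, S a j = B j (Z a)) :
    range (kerProj M B * (M.symm : ((∀ k, X k) →L[ℝ] ℝ) →L[ℝ] (∀ k, X k)).comp L * kerProj M B) =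
      M ⁻¹' range L ∩ ⋂ j, {v | B j v = 0} := by
  ext y
  simp only [mem_range, mem_inter_iff, mem_preimage, mem_iInter, mem_ofPred_eq,
    mul_apply_eq_comp, ContinuousLinearMap.comp_apply, ContinuousLinearEquiv.coe_coe]
  constructor
  · rintro ⟨x, rfl⟩
    refine ⟨⟨kerProj M B x - Z fun j => coef M B j (L (kerProj M B x)), ?_⟩,
      fun j => apply_kerProj hdet j _⟩
    rw [kerProj_symm_apply, M.apply_symm_apply, projB_apply, map_sub, hLZ]
  · rintro ⟨⟨x, hx⟩, hy⟩
    set a := S.symm fun j => B j x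
    have hBx (j : Fin r) : B j (x - Z a) = 0 := by
      rw [map_sub, ← hS, S.apply_symm_apply, sub_self]
    refine ⟨x - Z a, ?_⟩
    rw [(kerProj_eq_self_iff hdet).2 hBx, map_sub, hx, hLZ, map_sub, map_sub,
      kerProj_symm_sum_smul hdet, sub_zero, M.symm_apply_apply, (kerProj_eq_self_iff hdet).2 hy]

theorem isClosed_range_kerProj_mul_mul_kerProj (hdet : (gram M B).det ≠ 0)
    (hLZ : ∀ a, L (Z a) = ∑ j, a j • B j) (hS : ∀ a j, S a j = B j (Z a))
    (hL : IsClosed (range L)) :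
    IsClosed (range
      (kerProj M B * (M.symm : ((∀ k, X k) →L[ℝ] ℝ) →L[ℝ] (∀ k, X k)).comp L * kerProj M B)) := by
  rw [range_kerProj_mul_mul_kerProj hdet hLZ hS]
  exact (hL.preimage M.continuous).inter
    (isClosed_iInter fun j => isClosed_eq (B j).continuous continuous_const)

theorem apply_eq_zero_of_kerProj_symm_apply_eq_zero
    (hLZ : ∀ a, L (Z a) = ∑ j, a j • B j) (hS : ∀ a j, S a j = B j (Z a))
    (hker : ∀ v, L v = 0 → ∀ j, B j v = 0) {v : ∀ k, X k} (hBv : ∀ j, B j v = 0)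
    (hv : kerProj M B (M.symm (L v)) = 0) : L v = 0 := by
  set a := fun j => coef M B j (L v)
  have hLv : L v = ∑ j, a j • B j := by
    rw [← projB_apply]
    rw [kerProj_symm_apply] at hv
    exact sub_eq_zero.1 ((map_eq_zero_iff _ M.symm.injective).1 hv)
  have hLsub : L (v - Z a) = 0 := by rw [map_sub, hLZ, hLv, sub_self]
  have hSa : S a = 0 := by
    ext j
    rw [hS, ← sub_sub_cancel v (Z a), map_sub, hBv, hker _ hLsub, sub_zero, Pi.zero_apply]
  rw [hLv, (map_eq_zero_iff _ S.injective).1 hSa]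
  simp

end Family

end Projection

section ContDiffAt

variable {E F G : Type*} [NormedAddCommGroup E] [NormedSpace ℝ E] [NormedAddCommGroup F]
  [NormedSpace ℝ F] [NormedAddCommGroup G] [NormedSpace ℝ G] {r : ℕ} {x : E} {n : WithTop ℕ∞}

theorem contDiffAt_clm_flip {f : E → F →L[ℝ] G →L[ℝ] ℝ} (hf : ContDiffAt ℝ n f x) :
    ContDiffAt ℝ n (fun y => (f y).flip) x := by
  have hflip : ContDiff ℝ n (ContinuousLinearMap.flipₗᵢ ℝ F G ℝ) :=
    LinearIsometryEquiv.contDiff (E := F →L[ℝ] G →L[ℝ] ℝ) (F := G →L[ℝ] F →L[ℝ] ℝ) _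
  exact hflip.contDiffAt.comp x hf

theorem contDiffAt_smul_dual {f : E → ℝ} {g : E → F →L[ℝ] ℝ} (hf : ContDiffAt ℝ n f x)
    (hg : ContDiffAt ℝ n g x) : ContDiffAt ℝ n (fun y => f y • g y) x :=
  hf.smul hg

theorem contDiffAt_matrix_det {A : E → Matrix (Fin r) (Fin r) ℝ}
    (hA : ∀ i j, ContDiffAt ℝ n (fun y => A y i j) x) : ContDiffAt ℝ n (fun y => (A y).det) x := by
  simp only [Matrix.det_apply]
  exact ContDiffAt.sum fun σ _ => (contDiffAt_prod fun i _ => hA _ _).const_smul _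

theorem contDiffAt_matrix_inv {A : E → Matrix (Fin r) (Fin r) ℝ}
    (hA : ∀ i j, ContDiffAt ℝ n (fun y => A y i j) x) (hx : (A x).det ≠ 0) (i j : Fin r) :
    ContDiffAt ℝ n (fun y => (A y)⁻¹ i j) x := by
  simp only [Matrix.inv_def, Matrix.smul_apply, smul_eq_mul, Ring.inverse_eq_inv',
    Matrix.adjugate_apply]
  refine ((contDiffAt_matrix_det hA).inv hx).mul (contDiffAt_matrix_det fun k l => ?_)
  rcases eq_or_ne k j with rfl | hk
  · simpa only [Matrix.updateRow_self] using contDiffAt_const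
  · simpa only [Matrix.updateRow_ne hk] using hA k l

end ContDiffAt

section Scheme

variable {N r K : ℕ} {X : Fin K → Type*} [∀ k, NormedAddCommGroup (X k)]
  [∀ k, NormedSpace ℝ (X k)]

section Smoothness

variable (ι : ∀ k, X k →L[ℝ] L2 N) (q : Matrix (Fin r) (Fin K) ℝ) {n : WithTop ℕ∞}

theorem contDiff_embedding (k : Fin K) : ContDiff ℝ n fun u : ∀ k, X k => ι k (u k) :=
  ((ι k).comp (ContinuousLinearMap.proj k)).contDiff

theorem contDiff_power (k : Fin K) : ContDiff ℝ n (power ι k) :=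
  (contDiff_embedding ι k).inner ℝ (contDiff_embedding ι k)

theorem contDiff_quad (j : Fin r) : ContDiff ℝ n (quad ι q j) :=
  .sum fun k _ => contDiff_const.mul (contDiff_power ι k)

theorem contDiff_target (C : Fin r → ℝ) (k : Fin r) : ContDiff ℝ n (target ι q C k) :=
  contDiff_const.sub (.sum fun l _ => contDiff_const.mul (contDiff_power ι l))

theorem contDiff_colB (j : Fin r) : ContDiff ℝ n fun u => colB ι q u j := by
  refine .sum fun k _ => .const_smul _ (.clm_comp ?_ contDiff_const)
  exact (innerSL ℝ : L2 N →L[ℝ] L2 N →L[ℝ] ℝ).contDiff.comp (contDiff_embedding ι k)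

theorem contDiff_gram (M : (∀ k, X k) ≃L[ℝ] ((∀ k, X k) →L[ℝ] ℝ)) (i j : Fin r) :
    ContDiff ℝ n fun u => gram M (colB ι q u) i j :=
  (contDiff_colB ι q i).clm_apply (M.symm.contDiff.comp (contDiff_colB ι q j))

variable {ι q} {M : (∀ k, X k) ≃L[ℝ] ((∀ k, X k) →L[ℝ] ℝ)} {u : ∀ k, X k}
  {L00 : (∀ k, X k) → ((∀ k, X k) →L[ℝ] ℝ)}

theorem eventually_gram_det_ne_zero (hdet : (gram M (colB ι q u)).det ≠ 0) :
    ∀ᶠ v in 𝓝 u, (gram M (colB ι q v)).det ≠ 0 :=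
  (contDiffAt_matrix_det (n := 0) fun i j =>
    (contDiff_gram ι q M i j).contDiffAt).continuousAt.eventually_ne hdet

theorem contDiffAt_coef (hdet : (gram M (colB ι q u)).det ≠ 0) (j : Fin r) :
    ContDiffAt ℝ n (fun v => coef M (colB ι q v) j) u :=
  .sum fun i _ => contDiffAt_smul_dual
    (contDiffAt_matrix_inv (fun i j => (contDiff_gram ι q M i j).contDiffAt) hdet j i)
    ((contDiff_colB ι q i).contDiffAt.clm_comp contDiffAt_const)

theorem contDiffAt_one_sub_projB (hdet : (gram M (colB ι q u)).det ≠ 0) :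
    ContDiffAt ℝ n (fun v => 1 - projB M (colB ι q v)) u :=
  contDiffAt_const.sub (.sum fun j _ =>
    (contDiffAt_coef hdet j).smulRight (contDiff_colB ι q j).contDiffAt)

theorem contDiffAt_muOf (hdet : (gram M (colB ι q u)).det ≠ 0) (hL00 : ContDiffAt ℝ n L00 u) :
    ContDiffAt ℝ n (muOf ι q L00 M) u :=
  contDiffAt_pi.2 fun j => (contDiffAt_coef hdet j).clm_apply hL00

theorem contDiffAt_L0 (hL00 : ContDiffAt ℝ n L00 u) (μ : Fin r → ℝ) :
    ContDiffAt ℝ n (L0 ι q L00 μ) u :=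
  hL00.sub (.sum fun j _ => (contDiff_colB ι q j).contDiffAt.const_smul _)

theorem L0_muOf (v : ∀ k, X k) :
    L0 ι q L00 (muOf ι q L00 M v) v = (1 - projB M (colB ι q v)) (L00 v) := by
  simp [L0, muOf, projB_apply]

theorem uhat_eq (Δt : ℝ) (v : ∀ k, X k) : uhat ι q L00 M Δt v =
    v - Δt • M.symm ((1 - projB M (colB ι q v)) (force ι q L00 M v)) := by
  simp [uhat, gammaOf, projB_apply]

theorem contDiffAt_flip_L1_muOf (hdet : (gram M (colB ι q u)).det ≠ 0)
    (hL00 : ContDiffAt ℝ 2 L00 u) :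
    ContDiffAt ℝ 1 (fun v => (L1 ι q L00 (muOf ι q L00 M v) v).flip) u := by
  refine contDiffAt_clm_flip (ContDiffAt.fderiv (n := 2) (g := id)
    (f := fun v => L0 ι q L00 (muOf ι q L00 M v)) ?_ contDiffAt_id (by norm_num))
  refine (hL00.comp (u, u) contDiffAt_snd).sub (.sum fun j _ => contDiffAt_smul_dual ?_ ?_)
  · exact (contDiffAt_pi.1 (contDiffAt_muOf hdet hL00) j).comp (u, u) contDiffAt_fst
  · exact (contDiff_colB ι q j).contDiffAt.comp (u, u) contDiffAt_snd

theorem contDiffAt_force (hdet : (gram M (colB ι q u)).det ≠ 0) (hL00 : ContDiffAt ℝ 2 L00 u) :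
    ContDiffAt ℝ 1 (force ι q L00 M) u := by
  refine (contDiffAt_flip_L1_muOf hdet hL00).clm_apply (M.symm.contDiff.contDiffAt.comp u ?_)
  simp only [L0_muOf]
  exact (contDiffAt_one_sub_projB hdet).clm_apply (hL00.of_le (by norm_num))

theorem contDiffAt_uhat (hdet : (gram M (colB ι q u)).det ≠ 0) (hL00 : ContDiffAt ℝ 2 L00 u)
    (Δt : ℝ) : ContDiffAt ℝ 1 (uhat ι q L00 M Δt) u := by
  rw [show uhat ι q L00 M Δt = _ from funext (uhat_eq Δt)]
  exact contDiffAt_id.sub (.const_smul _ (M.symm.contDiff.contDiffAt.comp u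
    ((contDiffAt_one_sub_projB hdet).clm_apply (contDiffAt_force hdet hL00))))

end Smoothness

section Linearization

variable {ι : ∀ k, X k →L[ℝ] L2 N} {q : Matrix (Fin r) (Fin K) ℝ}
  {M : (∀ k, X k) ≃L[ℝ] ((∀ k, X k) →L[ℝ] ℝ)} {L00 : (∀ k, X k) → ((∀ k, X k) →L[ℝ] ℝ)}
  {μ : Fin r → ℝ} {u : ∀ k, X k}

theorem muOf_eq_of_L0_eq_zero (hdet : (gram M (colB ι q u)).det ≠ 0)
    (hu : L0 ι q L00 μ u = 0) : muOf ι q L00 M u = μ := by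
  have hL00 : L00 u = ∑ j, μ j • colB ι q u j := sub_eq_zero.1 hu
  rw [← coef_sum_smul hdet μ, ← hL00]
  rfl

theorem force_eq_zero_of_L0_eq_zero (hdet : (gram M (colB ι q u)).det ≠ 0)
    (hu : L0 ι q L00 μ u = 0) : force ι q L00 M u = 0 := by
  rw [force, muOf_eq_of_L0_eq_zero hdet hu, hu, map_zero, map_zero]

theorem uhat_eq_self_of_L0_eq_zero (hdet : (gram M (colB ι q u)).det ≠ 0)
    (hu : L0 ι q L00 μ u = 0) (Δt : ℝ) : uhat ι q L00 M Δt u = u := by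
  rw [uhat_eq, force_eq_zero_of_L0_eq_zero hdet hu, map_zero, map_zero, smul_zero, sub_zero]

theorem hasQuadraticError_L0_muOf (hdet : (gram M (colB ι q u)).det ≠ 0)
    (hL00 : ContDiffAt ℝ 2 L00 u) (hu : L0 ι q L00 μ u = 0) :
    HasQuadraticError (fun v => L0 ι q L00 (muOf ι q L00 M v) v)
      ((1 - projB M (colB ι q u)).comp (L1 ι q L00 μ u)) u := by
  refine (HasQuadraticError.clm_apply_of_eq_zero
    (((contDiffAt_one_sub_projB hdet).differentiableAt one_ne_zero).hasFDerivAt.isBigO_sub)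
    (.of_contDiffAt (contDiffAt_L0 hL00 μ)) hu).congr_of_eventuallyEq ?_
  filter_upwards [eventually_gram_det_ne_zero hdet] with v hv
  rw [L0_muOf, L0, map_sub, sub_apply _ _ (∑ j, μ j • colB ι q v j), projB_sum_smul hv,
    one_apply_eq_self, sub_self, sub_zero]

theorem hasQuadraticError_force (hdet : (gram M (colB ι q u)).det ≠ 0)
    (hL00 : ContDiffAt ℝ 2 L00 u) (hu : L0 ι q L00 μ u = 0) :
    HasQuadraticError (force ι q L00 M) (-LhatPCG ι q L00 M μ u) u := by
  have hforce := HasQuadraticError.clm_apply_of_eq_zero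
    ((contDiffAt_flip_L1_muOf hdet hL00).differentiableAt one_ne_zero).hasFDerivAt.isBigO_sub
    ((hasQuadraticError_L0_muOf hdet hL00 hu).clm_comp
      (M.symm : ((∀ k, X k) →L[ℝ] ℝ) →L[ℝ] (∀ k, X k)))
    (by simp [muOf_eq_of_L0_eq_zero hdet hu, hu])
  rw [muOf_eq_of_L0_eq_zero hdet hu] at hforce
  have hLhat : -LhatPCG ι q L00 M μ u = (L1 ι q L00 μ u).flip.comp
      ((M.symm : ((∀ k, X k) →L[ℝ] ℝ) →L[ℝ] (∀ k, X k)).comp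
        ((1 - projB M (colB ι q u)).comp (L1 ι q L00 μ u))) := by
    ext1 v
    simp [LhatPCG]
  rw [hLhat]
  exact hforce

theorem hasQuadraticError_uhat (hdet : (gram M (colB ι q u)).det ≠ 0)
    (hL00 : ContDiffAt ℝ 2 L00 u) (hu : L0 ι q L00 μ u = 0) (Δt : ℝ) :
    HasQuadraticError (uhat ι q L00 M Δt) (1 + Δt • LPCG ι q L00 M μ u) u := by
  have hproj := HasQuadraticError.clm_apply_of_eq_zero
    ((contDiffAt_one_sub_projB hdet).differentiableAt one_ne_zero).hasFDerivAt.isBigO_sub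
    (hasQuadraticError_force hdet hL00 hu) (force_eq_zero_of_L0_eq_zero hdet hu)
  convert (HasQuadraticError.clm 1 u).sub
    (hproj.clm_comp (Δt • (M.symm : ((∀ k, X k) →L[ℝ] ℝ) →L[ℝ] (∀ k, X k)))) using 1
  · funext v
    simp [uhat_eq]
  · ext1 v
    simp [LPCG, smul_sub]
    abel

end Linearization

end Scheme

section Normalization

variable {N r K : ℕ} {X : Fin K → Type*} [∀ k, NormedAddCommGroup (X k)]
  [∀ k, NormedSpace ℝ (X k)]

/-- The reduced echelon form of the coefficient matrix: its first `r` columns form the identity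
matrix. -/
def IsReducedEchelon (hrK : r ≤ K) (q : Matrix (Fin r) (Fin K) ℝ) : Prop :=
  ∀ i j : Fin r, q i (Fin.castLE hrK j) = if i = j then 1 else 0

/-- The normalization of the dependent powers, i.e. the second half of a step of the scheme. -/
def normalize (ι : ∀ k, X k →L[ℝ] L2 N) (q : Matrix (Fin r) (Fin K) ℝ) (C : Fin r → ℝ)
    (v : ∀ k, X k) : ∀ k, X k :=
  fun k => if h : (k : ℕ) < r then √(target ι q C ⟨k, h⟩ v / power ι k v) • v k else v k

variable {ι : ∀ k, X k →L[ℝ] L2 N} {q : Matrix (Fin r) (Fin K) ℝ} {C : Fin r → ℝ}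
  {hrK : r ≤ K} {u v w : ∀ k, X k}

theorem power_pos_of_ne_zero {k : Fin K} (hι : Function.Injective (ι k)) (hv : v k ≠ 0) :
    0 < power ι k v :=
  real_inner_self_pos.2 ((map_ne_zero_iff (ι k) hι).2 hv)

theorem power_eq_sq_mul_of_eq_smul {k : Fin K} {c : ℝ} (h : v k = c • w k) :
    power ι k v = c ^ 2 * power ι k w := by
  rw [power, h, map_smul, real_inner_smul_left, real_inner_smul_right, power, sq, mul_assoc]

theorem IsReducedEchelon.sum_lt_mul_power (hq : IsReducedEchelon hrK q) (k : Fin r)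
    (v : ∀ k, X k) :
    ∑ l with ¬ r ≤ l.val, q k l * power ι l v = power ι (Fin.castLE hrK k) v := by
  rw [Finset.sum_eq_single (Fin.castLE hrK k), hq, if_pos rfl, one_mul]
  · intro l hl hlk
    have hlr : (l : ℕ) < r := by simpa using hl
    have hkl : k ≠ ⟨l, hlr⟩ := fun h => hlk (by rw [h]; rfl)
    rw [show l = Fin.castLE hrK ⟨l, hlr⟩ from rfl, hq, if_neg hkl, zero_mul]
  · intro h
    exact absurd (Finset.mem_filter.2 ⟨Finset.mem_univ _, by simp⟩) h

theorem IsReducedEchelon.target_eq (hq : IsReducedEchelon hrK q) (k : Fin r) (v : ∀ k, X k) :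
    target ι q C k v = C k - quad ι q k v + power ι (Fin.castLE hrK k) v := by
  rw [target, quad, ← Finset.sum_filter_add_sum_filter_not Finset.univ
    (fun l : Fin K => r ≤ (l : ℕ)), hq.sum_lt_mul_power]
  ring

theorem IsReducedEchelon.target_eq_power (hq : IsReducedEchelon hrK q) {k : Fin r}
    (hC : quad ι q k v = C k) : target ι q C k v = power ι (Fin.castLE hrK k) v := by
  rw [hq.target_eq, hC, sub_self, zero_add]

theorem target_normalize (k : Fin r) :
    target ι q C k (normalize ι q C v) = target ι q C k v := by
  rw [target, target]
  congr 1
  refine Finset.sum_congr rfl fun l hl => ?_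
  have hlr : ¬ (l : ℕ) < r := by simpa using hl
  simp only [power, normalize, hlr, dite_false]

theorem power_normalize {k : Fin r} (hpow : 0 < power ι (Fin.castLE hrK k) v)
    (htar : 0 < target ι q C k v) :
    power ι (Fin.castLE hrK k) (normalize ι q C v) = target ι q C k v := by
  have hk : normalize ι q C v (Fin.castLE hrK k) =
      √(target ι q C k v / power ι (Fin.castLE hrK k) v) • v (Fin.castLE hrK k) := by
    simp [normalize]
  rw [power_eq_sq_mul_of_eq_smul hk, Real.sq_sqrt (div_pos htar hpow).le,
    div_mul_cancel₀ _ hpow.ne']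

theorem IsReducedEchelon.quad_normalize (hq : IsReducedEchelon hrK q) {k : Fin r}
    (hpow : 0 < power ι (Fin.castLE hrK k) v) (htar : 0 < target ι q C k v) :
    quad ι q k (normalize ι q C v) = C k := by
  have h := hq.target_eq (ι := ι) (C := C) k (normalize ι q C v)
  rw [target_normalize, power_normalize hpow htar] at h
  linarith

theorem IsReducedEchelon.normalize_eq_self (hq : IsReducedEchelon hrK q)
    (hpow : ∀ k : Fin K, (k : ℕ) < r → 0 < power ι k v) (hC : ∀ j, quad ι q j v = C j) :
    normalize ι q C v = v := by
  funext k
  by_cases h : (k : ℕ) < r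
  · have htarget : target ι q C ⟨k, h⟩ v = power ι k v := hq.target_eq_power (hC _)
    simp [normalize, h, htarget, (hpow k h).ne']
  · simp [normalize, h]

theorem contDiffAt_normalize (hpow : ∀ k : Fin K, (k : ℕ) < r → 0 < power ι k u)
    (htar : ∀ k, 0 < target ι q C k u) {n : WithTop ℕ∞} :
    ContDiffAt ℝ n (normalize ι q C) u := by
  refine contDiffAt_pi.2 fun k => ?_
  have hk : ContDiffAt ℝ n (fun v : ∀ k, X k => v k) u :=
    (ContinuousLinearMap.proj (R := ℝ) (φ := X) k).contDiff.contDiffAt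
  by_cases h : (k : ℕ) < r
  · simp only [normalize, h, dite_true]
    exact (((contDiff_target ι q C _).contDiffAt.div (contDiff_power ι k).contDiffAt
      (hpow k h).ne').sqrt (div_pos (htar _) (hpow k h)).ne').smul hk
  · simpa only [normalize, h, dite_false] using hk

theorem eventually_power_pos_and_target_pos
    (hpow : ∀ k : Fin K, (k : ℕ) < r → 0 < power ι k u) (htar : ∀ k, 0 < target ι q C k u) :
    ∀ᶠ v in 𝓝 u, (∀ k : Fin K, (k : ℕ) < r → 0 < power ι k v) ∧ ∀ k, 0 < target ι q C k v := by
  simp only [eventually_and, eventually_all]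
  exact ⟨fun k hk => (contDiff_power (n := 0) ι k).continuous.continuousAt.eventually
      (lt_mem_nhds (hpow k hk)),
    fun k => (contDiff_target (n := 0) ι q C k).continuous.continuousAt.eventually
      (lt_mem_nhds (htar k))⟩

theorem IsReducedEchelon.hasFDerivAt_sqrt_target_div_power (hq : IsReducedEchelon hrK q)
    {k : Fin r} (hpow : 0 < power ι (Fin.castLE hrK k) u) (hC : quad ι q k u = C k) :
    HasFDerivAt (fun v => √(target ι q C k v / power ι (Fin.castLE hrK k) v))
      (-(2 * power ι (Fin.castLE hrK k) u)⁻¹ • colB ι q u k) u := by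
  have hpower : ContDiff ℝ 1 (power ι (Fin.castLE hrK k)) := contDiff_power ι _
  have hinv := (hpower.contDiffAt.inv hpow.ne').differentiableAt one_ne_zero
  have hprod := hinv.hasFDerivAt.mul ((hasFDerivAt_quad ι q k u).const_sub (C k))
  have hquot : HasFDerivAt (fun v => target ι q C k v / power ι (Fin.castLE hrK k) v)
      (-(power ι (Fin.castLE hrK k) u)⁻¹ • colB ι q u k) u := by
    refine ((hprod.const_add 1).congr_of_eventuallyEq ?_).congr_fderiv (by ext; simp [hC])
    filter_upwards [hpower.continuous.continuousAt.eventually (lt_mem_nhds hpow)] with v hv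
    rw [hq.target_eq, Pi.mul_apply, Pi.inv_apply]
    field_simp
    ring
  have hone : target ι q C k u / power ι (Fin.castLE hrK k) u = 1 := by
    rw [hq.target_eq_power hC, div_self hpow.ne']
  refine (hquot.sqrt (by rw [hone]; exact one_ne_zero)).congr_fderiv ?_
  rw [hone, smul_smul]
  congr 1
  simp
  ring

theorem IsReducedEchelon.fderiv_normalize_apply_eq_self (hq : IsReducedEchelon hrK q)
    (hpow : ∀ k : Fin K, (k : ℕ) < r → 0 < power ι k u) (hC : ∀ j, quad ι q j u = C j)
    (hv : ∀ j, colB ι q u j v = 0) : fderiv ℝ (normalize ι q C) u v = v := by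
  have hnorm : DifferentiableAt ℝ (normalize ι q C) u :=
    (contDiffAt_normalize hpow fun k => by
      rw [hq.target_eq_power (hC k)]; exact hpow _ k.2).differentiableAt one_ne_zero
  funext k
  have hproj : HasFDerivAt (fun w : ∀ k, X k => w k) (ContinuousLinearMap.proj (R := ℝ) k) u :=
    (ContinuousLinearMap.proj (R := ℝ) (φ := X) k).hasFDerivAt
  have hcomp : HasFDerivAt (fun w => normalize ι q C w k)
      ((ContinuousLinearMap.proj k).comp (fderiv ℝ (normalize ι q C) u)) u :=
    hasFDerivAt_pi'.1 hnorm.hasFDerivAt k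
  by_cases h : (k : ℕ) < r
  · have hsqrt := hq.hasFDerivAt_sqrt_target_div_power (k := ⟨k, h⟩) (hpow k h) (hC _)
    have hone : √(target ι q C ⟨k, h⟩ u / power ι (Fin.castLE hrK ⟨k, h⟩) u) = 1 := by
      rw [hq.target_eq_power (hC _)]
      exact (congrArg _ (div_self (hpow k h).ne')).trans Real.sqrt_one
    have hsmul := hsqrt.fun_smul hproj
    rw [hone] at hsmul
    simp only [normalize, h, dite_true] at hcomp
    simpa [hv] using congr($(hcomp.unique hsmul) v)
  · simp only [normalize, h, dite_false] at hcomp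
    exact congr($(hcomp.unique hproj) v)

theorem IsReducedEchelon.colB_comp_fderiv_normalize (hq : IsReducedEchelon hrK q)
    (hpow : ∀ k : Fin K, (k : ℕ) < r → 0 < power ι k u) (hC : ∀ j, quad ι q j u = C j)
    (j : Fin r) : (colB ι q u j).comp (fderiv ℝ (normalize ι q C) u) = 0 := by
  have htar : ∀ k, 0 < target ι q C k u := fun k => by
    rw [hq.target_eq_power (hC k)]
    exact hpow _ k.2
  have hquad : HasFDerivAt (quad ι q j) (colB ι q u j) (normalize ι q C u) := by
    rw [hq.normalize_eq_self hpow hC]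
    exact hasFDerivAt_quad ι q j u
  have hcomp := hquad.comp u
    ((contDiffAt_normalize hpow htar).differentiableAt one_ne_zero).hasFDerivAt
  refine hcomp.unique ((hasFDerivAt_const (C j) u).congr_of_eventuallyEq ?_)
  filter_upwards [eventually_power_pos_and_target_pos hpow htar] with v hv
  exact hq.quad_normalize (hv.1 _ j.2) (hv.2 j)

end Normalization

section Step

variable {N r K : ℕ} {X : Fin K → Type*} [∀ k, NormedAddCommGroup (X k)]
  [∀ k, NormedSpace ℝ (X k)] {ι : ∀ k, X k →L[ℝ] L2 N} {q : Matrix (Fin r) (Fin K) ℝ}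
  {C : Fin r → ℝ} {L00 : (∀ k, X k) → ((∀ k, X k) →L[ℝ] ℝ)}
  {M : (∀ k, X k) ≃L[ℝ] ((∀ k, X k) →L[ℝ] ℝ)} {u : ∀ k, X k} {μ : Fin r → ℝ} {Δt : ℝ}
  {hrK : r ≤ K}

/-- A solution `u` of `L₀u = 0` with propagation constants `μ` and prescribed values `Q(u) = C`,
all of whose dependent components are nonzero in `L²`. -/
structure IsSolitaryWave (ι : ∀ k, X k →L[ℝ] L2 N) (q : Matrix (Fin r) (Fin K) ℝ)
    (C : Fin r → ℝ) (L00 : (∀ k, X k) → ((∀ k, X k) →L[ℝ] ℝ)) (μ : Fin r → ℝ)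
    (u : ∀ k, X k) : Prop where
  L0_eq_zero : L0 ι q L00 μ u = 0
  quad_eq : ∀ j, quad ι q j u = C j
  power_pos : ∀ k : Fin K, (k : ℕ) < r → 0 < power ι k u

theorem IsReducedEchelon.colB_apply_single (hq : IsReducedEchelon hrK q) (u : ∀ k, X k)
    (i j : Fin r) : colB ι q u j (Pi.single (Fin.castLE hrK i) (u (Fin.castLE hrK i))) =
      2 * (if j = i then 1 else 0) * power ι (Fin.castLE hrK i) u := by
  rw [← hq j i]
  simp only [colB, sum_apply, smul_apply, smul_eq_mul, ContinuousLinearMap.comp_apply,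
    ContinuousLinearMap.proj_apply, innerSL_apply_apply]
  rw [Finset.sum_eq_single (Fin.castLE hrK i)]
  · simp [power]
  · intro l _ hl
    simp [Pi.single_eq_of_ne hl]
  · simp

theorem IsReducedEchelon.linearIndependent_colB (hq : IsReducedEchelon hrK q)
    (hpow : ∀ k : Fin K, (k : ℕ) < r → 0 < power ι k u) :
    LinearIndependent ℝ (colB ι q u) := by
  refine Fintype.linearIndependent_iff.2 fun a ha i => ?_
  have happly := congr($ha (Pi.single (Fin.castLE hrK i) (u (Fin.castLE hrK i))))
  simpa [sum_apply, hq.colB_apply_single, (hpow (Fin.castLE hrK i) i.2).ne'] using happly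

theorem colB_LPCG_apply (hdet : (gram M (colB ι q u)).det ≠ 0) (j : Fin r) (v : ∀ k, X k) :
    colB ι q u j (LPCG ι q L00 M μ u v) = 0 := by
  simp only [LPCG, ContinuousLinearMap.comp_apply, sub_apply, ContinuousLinearEquiv.coe_coe,
    map_sub, apply_symm_projB hdet, sub_self]

theorem step_eq_comp : step ι q C L00 M Δt = normalize ι q C ∘ uhat ι q L00 M Δt := rfl

namespace IsSolitaryWave

variable (hu : IsSolitaryWave ι q C L00 μ u)
include hu

theorem target_pos (hq : IsReducedEchelon hrK q) (k : Fin r) : 0 < target ι q C k u := by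
  rw [hq.target_eq_power (hu.quad_eq k)]
  exact hu.power_pos _ k.2

theorem step_eq_self (hq : IsReducedEchelon hrK q) (hdet : (gram M (colB ι q u)).det ≠ 0) :
    step ι q C L00 M Δt u = u := by
  rw [step_eq_comp, Function.comp_apply, uhat_eq_self_of_L0_eq_zero hdet hu.L0_eq_zero,
    hq.normalize_eq_self hu.power_pos hu.quad_eq]

theorem eventually_stepDefined (hq : IsReducedEchelon hrK q)
    (hdet : (gram M (colB ι q u)).det ≠ 0) (hL00 : ContDiffAt ℝ 2 L00 u) :
    ∀ᶠ v in 𝓝 u, StepDefined ι q C L00 M Δt v := by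
  have huhat := (contDiffAt_uhat hdet hL00 Δt).continuousAt.tendsto
  rw [uhat_eq_self_of_L0_eq_zero hdet hu.L0_eq_zero] at huhat
  filter_upwards [hL00.eventually (by simp), eventually_gram_det_ne_zero hdet, huhat.eventually
    (eventually_power_pos_and_target_pos hu.power_pos (hu.target_pos hq))] with v hv hgram hpos
  exact ⟨hv.differentiableAt two_ne_zero, hgram, hpos.1, hpos.2⟩

theorem contDiffAt_step (hq : IsReducedEchelon hrK q) (hdet : (gram M (colB ι q u)).det ≠ 0)
    (hL00 : ContDiffAt ℝ 2 L00 u) : ContDiffAt ℝ 1 (step ι q C L00 M Δt) u := by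
  have hnorm : ContDiffAt ℝ 1 (normalize ι q C) (uhat ι q L00 M Δt u) := by
    rw [uhat_eq_self_of_L0_eq_zero hdet hu.L0_eq_zero]
    exact contDiffAt_normalize hu.power_pos (hu.target_pos hq)
  exact hnorm.comp u (contDiffAt_uhat hdet hL00 Δt)

theorem hasQuadraticError_step (hq : IsReducedEchelon hrK q)
    (hdet : (gram M (colB ι q u)).det ≠ 0) (hL00 : ContDiffAt ℝ 2 L00 u) :
    HasQuadraticError (step ι q C L00 M Δt)
      (fderiv ℝ (normalize ι q C) u * (1 + Δt • LPCG ι q L00 M μ u)) u := by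
  have hnorm : HasQuadraticError (normalize ι q C) (fderiv ℝ (normalize ι q C) u)
      (uhat ι q L00 M Δt u) := by
    rw [uhat_eq_self_of_L0_eq_zero hdet hu.L0_eq_zero]
    exact .of_contDiffAt (contDiffAt_normalize hu.power_pos (hu.target_pos hq))
  exact hnorm.comp (hasQuadraticError_uhat hdet hL00 hu.L0_eq_zero Δt)

theorem kerProj_mul_fderiv_step (hq : IsReducedEchelon hrK q)
    (hdet : (gram M (colB ι q u)).det ≠ 0) (hL00 : ContDiffAt ℝ 2 L00 u) :
    kerProj M (colB ι q u) * fderiv ℝ (step ι q C L00 M Δt) u =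
      fderiv ℝ (step ι q C L00 M Δt) u := by
  rw [(hu.hasQuadraticError_step hq hdet hL00).hasFDerivAt.fderiv]
  exact kerProj_mul_eq_self hdet fun j v =>
    congr($(hq.colB_comp_fderiv_normalize hu.power_pos hu.quad_eq j) _)

theorem fderiv_step_mul_kerProj (hq : IsReducedEchelon hrK q)
    (hdet : (gram M (colB ι q u)).det ≠ 0) (hL00 : ContDiffAt ℝ 2 L00 u) :
    fderiv ℝ (step ι q C L00 M Δt) u * kerProj M (colB ι q u) =
      kerProj M (colB ι q u) + Δt • (LPCG ι q L00 M μ u * kerProj M (colB ι q u)) := by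
  have hrange : ∀ j v, colB ι q u j (kerProj M (colB ι q u) v +
      Δt • LPCG ι q L00 M μ u (kerProj M (colB ι q u) v)) = 0 := fun j v => by
    rw [map_add, map_smul, apply_kerProj hdet, colB_LPCG_apply hdet, smul_zero, add_zero]
  rw [(hu.hasQuadraticError_step hq hdet hL00).hasFDerivAt.fderiv]
  ext1 v
  exact hq.fderiv_normalize_apply_eq_self hu.power_pos hu.quad_eq fun j => hrange j v

end IsSolitaryWave

end Step

section Family

variable {N r K s : ℕ} {X : Fin K → Type*} [∀ k, NormedAddCommGroup (X k)]
  [∀ k, NormedSpace ℝ (X k)] {ι : ∀ k, X k →L[ℝ] L2 N} {q : Matrix (Fin r) (Fin K) ℝ}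
  {C : Fin r → ℝ} {L00 : (∀ k, X k) → ((∀ k, X k) →L[ℝ] ℝ)}
  {U : (Fin s → ℝ) → (Fin r → ℝ) → ∀ k, X k} {c₀ : Fin s → ℝ} {μ₀ : Fin r → ℝ}
  {U' : (Fin s → ℝ) × (Fin r → ℝ) →L[ℝ] ∀ k, X k}

theorem L0_eq_L0_sub_sum (μ ν : Fin r → ℝ) (v : ∀ k, X k) :
    L0 ι q L00 ν v = L0 ι q L00 μ v - ∑ j, (ν j - μ j) • colB ι q v j := by
  rw [L0, L0, sub_sub, ← Finset.sum_add_distrib]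
  congr 1
  refine Finset.sum_congr rfl fun j _ => ?_
  rw [← add_smul, add_sub_cancel]

theorem hasFDerivAt_sum_sub_smul_colB (hU : DifferentiableAt ℝ (fun p => U p.1 p.2) (c₀, μ₀)) :
    HasFDerivAt (fun p : (Fin s → ℝ) × (Fin r → ℝ) =>
        ∑ j, (p.2 j - μ₀ j) • colB ι q (U p.1 p.2) j)
      (∑ j, ((ContinuousLinearMap.proj j).comp
        (ContinuousLinearMap.snd ℝ (Fin s → ℝ) (Fin r → ℝ))).smulRight
          (colB ι q (U c₀ μ₀) j)) (c₀, μ₀) := by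
  refine HasFDerivAt.fun_sum fun j _ => ?_
  have hscalar : HasFDerivAt (fun p : (Fin s → ℝ) × (Fin r → ℝ) => p.2 j - μ₀ j)
      ((ContinuousLinearMap.proj j).comp (ContinuousLinearMap.snd ℝ (Fin s → ℝ) (Fin r → ℝ)))
      (c₀, μ₀) :=
    ((ContinuousLinearMap.proj j).comp
      (ContinuousLinearMap.snd ℝ (Fin s → ℝ) (Fin r → ℝ))).hasFDerivAt.sub_const _
  have hcol := (((contDiff_colB (n := 1) ι q j).differentiable one_ne_zero _).comp _ hU)
  refine (hscalar.smul hcol.hasFDerivAt).congr_fderiv ?_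
  simp

theorem L1_apply_hasFDerivAt (hU : HasFDerivAt (fun p => U p.1 p.2) U' (c₀, μ₀))
    (hsol : ∀ᶠ p in 𝓝 (c₀, μ₀), L0 ι q L00 p.2 (U p.1 p.2) = 0)
    (hL00 : ContDiffAt ℝ 1 L00 (U c₀ μ₀)) (p : (Fin s → ℝ) × (Fin r → ℝ)) :
    L1 ι q L00 μ₀ (U c₀ μ₀) (U' p) = ∑ j, p.2 j • colB ι q (U c₀ μ₀) j := by
  have hL0 : HasFDerivAt (L0 ι q L00 μ₀) (L1 ι q L00 μ₀ (U c₀ μ₀)) (U c₀ μ₀) :=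
    ((contDiffAt_L0 hL00 μ₀).differentiableAt one_ne_zero).hasFDerivAt
  have hzero := (hL0.comp (c₀, μ₀) hU).sub
    (hasFDerivAt_sum_sub_smul_colB (ι := ι) (q := q) hU.differentiableAt)
  have hunique := hzero.unique ((hasFDerivAt_const 0 _).congr_of_eventuallyEq ?_)
  · simpa [sub_eq_zero, sum_apply] using congr($hunique p)
  · filter_upwards [hsol] with p hp
    rw [← hp, L0_eq_L0_sub_sum μ₀]
    rfl

theorem span_range_invarianceMode {V : (Fin s → ℝ) → ∀ k, X k}
    {W : (Fin s → ℝ) →L[ℝ] ∀ k, X k} (hV : HasFDerivAt V W c₀) :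
    Submodule.span ℝ (range (invarianceMode V c₀)) = W.toLinearMap.range := by
  have hmode : invarianceMode V c₀ = W.toLinearMap ∘ Pi.basisFun ℝ (Fin s) := by
    funext j
    simp [invarianceMode, hV.fderiv]
  rw [hmode, range_comp, ← Submodule.map_span, (Pi.basisFun ℝ (Fin s)).span_eq,
    LinearMap.range_eq_map]

theorem exists_equiv_of_Dhat_det_ne_zero {V : (Fin r → ℝ) → ∀ k, X k}
    {Z : (Fin r → ℝ) →L[ℝ] ∀ k, X k} (hV : HasFDerivAt V Z μ₀) (hD : (Dhat ι q V μ₀).det ≠ 0) :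
    ∃ S : (Fin r → ℝ) ≃L[ℝ] (Fin r → ℝ), ∀ a j, S a j = colB ι q (V μ₀) j (Z a) := by
  let f : (Fin r → ℝ) →ₗ[ℝ] (Fin r → ℝ) :=
    LinearMap.pi fun j => ((colB ι q (V μ₀) j).comp Z).toLinearMap
  have hDf : Dhat ι q V μ₀ = LinearMap.toMatrix' f := by
    ext i j
    have hquad : HasFDerivAt (fun ν => quad ι q i (V ν)) _ μ₀ :=
      (hasFDerivAt_quad ι q i (V μ₀)).comp μ₀ hV
    simp [Dhat, hquad.fderiv, f, LinearMap.toMatrix'_apply]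
  rw [hDf, LinearMap.det_toMatrix'] at hD
  exact ⟨(LinearMap.equivOfDetNeZero f hD).toContinuousLinearEquiv, fun a j => by simp [f]⟩

theorem hasStrictFDerivAt_quad_comp {V : Type*} [NormedAddCommGroup V] [NormedSpace ℝ V]
    {f : V → ∀ k, X k} {f' : V →L[ℝ] ∀ k, X k} {x : V} (hf : HasStrictFDerivAt f f' x) :
    HasStrictFDerivAt (fun y j => quad ι q j (f y))
      (ContinuousLinearMap.pi fun j => (colB ι q (f x) j).comp f') x := by
  refine hasStrictFDerivAt_pi.2 fun j => HasStrictFDerivAt.comp x ?_ hf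
  rw [← (hasFDerivAt_quad ι q j (f x)).fderiv]
  exact (contDiff_quad (n := 1) ι q j).contDiffAt.hasStrictFDerivAt one_ne_zero

theorem exists_family_quad_eq (hU : HasStrictFDerivAt (fun p => U p.1 p.2) U' (c₀, μ₀))
    {S : (Fin r → ℝ) ≃L[ℝ] (Fin r → ℝ)}
    (hS : ∀ a j, S a j = colB ι q (U c₀ μ₀) j (U' (0, a)))
    (hC : ∀ j, quad ι q j (U c₀ μ₀) = C j) (hB : ∀ j c, colB ι q (U c₀ μ₀) j (U' (c, 0)) = 0) :
    ∃ m : (Fin s → ℝ) → (Fin r → ℝ), m c₀ = μ₀ ∧ Tendsto m (𝓝 c₀) (𝓝 μ₀) ∧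
      (∀ᶠ c in 𝓝 c₀, ∀ j, quad ι q j (U c (m c)) = C j) ∧
      HasStrictFDerivAt (fun c => U c (m c))
        (U'.comp (ContinuousLinearMap.inl ℝ (Fin s → ℝ) (Fin r → ℝ))) c₀ := by
  have hquad := hasStrictFDerivAt_quad_comp (ι := ι) (q := q) hU
  have hinv : ((ContinuousLinearMap.pi fun j => (colB ι q (U c₀ μ₀) j).comp U').comp
      (ContinuousLinearMap.inr ℝ (Fin s → ℝ) (Fin r → ℝ))).IsInvertible :=
    ⟨S, by ext1 a; funext j; simp [hS]⟩
  have hinl : (ContinuousLinearMap.pi fun j => (colB ι q (U c₀ μ₀) j).comp U').comp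
      (ContinuousLinearMap.inl ℝ (Fin s → ℝ) (Fin r → ℝ)) = 0 := by
    ext1 c
    funext j
    simp [hB]
  have hm := hquad.hasStrictFDerivAt_implicitFunctionOfProdDomain hinv
  rw [hinl, ContinuousLinearMap.comp_zero, neg_zero] at hm
  have hm₀ : hquad.implicitFunctionOfProdDomain hinv c₀ = μ₀ :=
    (hquad.eventually_apply_eq_iff_implicitFunctionOfProdDomain hinv).self_of_nhds.1 rfl
  refine ⟨_, hm₀, hquad.tendsto_implicitFunctionOfProdDomain hinv, ?_, ?_⟩
  · filter_upwards [hquad.eventually_apply_implicitFunctionOfProdDomain hinv] with c hc j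
    exact congr($hc j).trans (hC j)
  · rw [← hm₀] at hU
    exact hU.comp c₀ ((hasStrictFDerivAt_id c₀).prodMk hm)

end Family

section Convergence

variable {N r K s : ℕ} {X : Fin K → Type*} [∀ k, NormedAddCommGroup (X k)]
  [∀ k, NormedSpace ℝ (X k)] {ι : ∀ k, X k →L[ℝ] L2 N}
  {q : Matrix (Fin r) (Fin K) ℝ} {C : Fin r → ℝ}
  {L00 : (∀ k, X k) → ((∀ k, X k) →L[ℝ] ℝ)}
  {M : (∀ k, X k) ≃L[ℝ] ((∀ k, X k) →L[ℝ] ℝ)} {u : ∀ k, X k} {μ : Fin r → ℝ} {Δt : ℝ}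
  {hrK : r ≤ K} {U : (Fin s → ℝ) → (Fin r → ℝ) → ∀ k, X k} {c₀ : Fin s → ℝ} {μ₀ : Fin r → ℝ}

theorem IsSolitaryWave.gram_det_ne_zero (hu : IsSolitaryWave ι q C L00 μ u)
    (hq : IsReducedEchelon hrK q) (hM : IsHermitianPosDef M) :
    (gram M (colB ι q u)).det ≠ 0 :=
  PCSOM.gram_det_ne_zero hM (hq.linearIndependent_colB hu.power_pos)

theorem IsSolitaryWave.eventually_family {m : (Fin s → ℝ) → (Fin r → ℝ)}
    (hu : IsSolitaryWave ι q C L00 μ₀ (U c₀ μ₀)) (hm : Tendsto m (𝓝 c₀) (𝓝 μ₀))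
    (hUsol : ∀ᶠ p in 𝓝 (c₀, μ₀), L0 ι q L00 p.2 (U p.1 p.2) = 0)
    (hU : ContinuousAt (fun p : (Fin s → ℝ) × (Fin r → ℝ) => U p.1 p.2) (c₀, μ₀))
    (hquad : ∀ᶠ c in 𝓝 c₀, ∀ j, quad ι q j (U c (m c)) = C j)
    (hq : IsReducedEchelon hrK q) :
    ∀ᶠ c in 𝓝 c₀, IsSolitaryWave ι q C L00 (m c) (U c (m c)) := by
  have hpair : Tendsto (fun c => (c, m c)) (𝓝 c₀) (𝓝 (c₀, μ₀)) := tendsto_id.prodMk_nhds hm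
  filter_upwards [hpair.eventually hUsol, hquad, (hU.tendsto.comp hpair).eventually
    (eventually_power_pos_and_target_pos hu.power_pos (hu.target_pos hq))] with c hsol hc hpos
  exact ⟨hsol, hc, hpos.1⟩

theorem mem_range_of_L1_eq_zero {U' : (Fin s → ℝ) × (Fin r → ℝ) →L[ℝ] ∀ k, X k}
    (hU : HasFDerivAt (fun p => U p.1 p.2) U' (c₀, μ₀))
    (hker : LinearMap.ker (L1 ι q L00 μ₀ u).toLinearMap =
      Submodule.span ℝ (range (invarianceMode (fun c => U c μ₀) c₀)))
    {v : ∀ k, X k} (hv : L1 ι q L00 μ₀ u v = 0) :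
    v ∈ range (U'.comp (ContinuousLinearMap.inl ℝ (Fin s → ℝ) (Fin r → ℝ))) := by
  have hmode : HasFDerivAt (fun c => U c μ₀) (U'.comp (ContinuousLinearMap.inl ℝ _ _)) c₀ :=
    HasFDerivAt.comp (𝕜 := ℝ) (g := fun p : _ × _ => U p.1 p.2) c₀ hU
      (hasFDerivAt_prodMk_left c₀ μ₀)
  rw [span_range_invarianceMode hmode] at hker
  exact hker.le hv

variable [∀ k, CompleteSpace (X k)]

theorem IsSolitaryWave.exists_tendsto_fderiv_step_pow (hu : IsSolitaryWave ι q C L00 μ u)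
    (hq : IsReducedEchelon hrK q) (hM : IsHermitianPosDef M) (hL00 : ContDiffAt ℝ 2 L00 u)
    {Z : (Fin r → ℝ) → ∀ k, X k} {S : (Fin r → ℝ) ≃L[ℝ] (Fin r → ℝ)}
    (hLZ : ∀ a, L1 ι q L00 μ u (Z a) = ∑ j, a j • colB ι q u j)
    (hS : ∀ a j, S a j = colB ι q u j (Z a))
    (hB : ∀ j v, L1 ι q L00 μ u v = 0 → colB ι q u j v = 0)
    (hclosed : IsClosed (range (L1 ι q L00 μ u))) (hΔt : 0 < Δt)
    (hlt : ENNReal.ofReal Δt < dtMax (lambdaMin (LPCG ι q L00 M μ u))) :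
    ∃ P, Tendsto (fun n => fderiv ℝ (step ι q C L00 M Δt) u ^ n) atTop (𝓝 P) ∧
      ∀ v, L1 ι q L00 μ u (P v) = 0 := by
  have hdet := hu.gram_det_ne_zero hq hM
  have hDQ := hu.fderiv_step_mul_kerProj (Δt := Δt) hq hdet hL00
  rw [LPCG_eq] at hlt hDQ
  obtain ⟨P, hP, hTP, hQP⟩ := hM.exists_tendsto_pow_of_lt_dtMax (kerProj_mul_self hdet)
    (apply_kerProj_comm hM hdet) (apply_symm_comp_flip hM)
    (hu.kerProj_mul_fderiv_step hq hdet hL00) hDQ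
    (isClosed_range_kerProj_mul_mul_kerProj hdet hLZ hS hclosed) hΔt hlt
  refine ⟨P, hP, fun v => ?_⟩
  have hQPv : kerProj M (colB ι q u) (P v) = P v := congr($hQP v)
  refine apply_eq_zero_of_kerProj_symm_apply_eq_zero (M := M) hLZ hS (fun w hw j => hB j w hw)
    ((kerProj_eq_self_iff hdet).1 hQPv) ?_
  rw [← hQPv]
  exact congr($hTP v)

theorem IsSolitaryWave.eventually_tendsto_step (hu : IsSolitaryWave ι q C L00 μ₀ (U c₀ μ₀))
    (hq : IsReducedEchelon hrK q) (hM : IsHermitianPosDef M)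
    (hU : ContDiffAt ℝ 1 (fun p : (Fin s → ℝ) × (Fin r → ℝ) => U p.1 p.2) (c₀, μ₀))
    (hUsol : ∀ᶠ p in 𝓝 (c₀, μ₀), L0 ι q L00 p.2 (U p.1 p.2) = 0)
    (hL00 : ContDiffAt ℝ 2 L00 (U c₀ μ₀))
    (hker : LinearMap.ker (L1 ι q L00 μ₀ (U c₀ μ₀)).toLinearMap =
      Submodule.span ℝ (range (invarianceMode (fun c => U c μ₀) c₀)))
    (hB : ∀ j v, L1 ι q L00 μ₀ (U c₀ μ₀) v = 0 → colB ι q (U c₀ μ₀) j v = 0)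
    (hD : (Dhat ι q (U c₀) μ₀).det ≠ 0) (hclosed : IsClosed (range (L1 ι q L00 μ₀ (U c₀ μ₀))))
    (hΔt : 0 < Δt) (hlt : ENNReal.ofReal Δt < dtMax (lambdaMin (LPCG ι q L00 M μ₀ (U c₀ μ₀))))
    {t : Set (∀ k, X k)} (ht : t ∈ 𝓝 (U c₀ μ₀)) {T : Set ((Fin s → ℝ) × (Fin r → ℝ))}
    (hT : T ∈ 𝓝 (c₀, μ₀)) :
    ∀ᶠ u₀ in 𝓝 (U c₀ μ₀), (∀ n, (step ι q C L00 M Δt)^[n] u₀ ∈ t) ∧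
      ∃ c μ, (c, μ) ∈ T ∧ IsSolitaryWave ι q C L00 μ (U c μ) ∧
        Tendsto (fun n => (step ι q C L00 M Δt)^[n] u₀) atTop (𝓝 (U c μ)) := by
  have hU' := hU.hasStrictFDerivAt one_ne_zero
  have hL1 := L1_apply_hasFDerivAt hU'.hasFDerivAt hUsol (hL00.of_le one_le_two)
  obtain ⟨S, hS⟩ := exists_equiv_of_Dhat_det_ne_zero
    (hU'.hasFDerivAt.comp μ₀ (hasFDerivAt_prodMk_right c₀ μ₀)) hD
  obtain ⟨m, rfl, hm, hquad, hw⟩ := exists_family_quad_eq hU' hS hu.quad_eq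
    fun j c => hB j _ (by simp [hL1])
  obtain ⟨P, hP, hLP⟩ := hu.exists_tendsto_fderiv_step_pow hq hM hL00 (fun a => hL1 (0, a)) hS hB
    hclosed hΔt hlt
  have hwave := hu.eventually_family hm hUsol hU.continuousAt hquad hq
  have hfix : ∀ᶠ c in 𝓝 c₀, step ι q C L00 M Δt (U c (m c)) = U c (m c) :=
    hwave.mono fun c hc => hc.step_eq_self hq (hc.gram_det_ne_zero hq hM)
  have hstep := (hu.contDiffAt_step (Δt := Δt) hq (hu.gram_det_ne_zero hq hM)
    hL00).hasStrictFDerivAt one_ne_zero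
  have hs := hwave.and ((tendsto_id.prodMk_nhds hm).eventually hT)
  filter_upwards [eventually_tendsto_family (w := fun c => U c (m c)) hstep hw hfix hP
    (fun v => mem_range_of_L1_eq_zero hU'.hasFDerivAt hker (hLP v)) ht hs]
    with u₀ ⟨hmem, c, hc, hlim⟩
  exact ⟨hmem, c, m c, hc.2, hc.1, hlim⟩

theorem IsSolitaryWave.exists_escape_step (hu : IsSolitaryWave ι q C L00 μ u)
    (hq : IsReducedEchelon hrK q) (hM : IsHermitianPosDef M) (hL00 : ContDiffAt ℝ 2 L00 u)
    (hΔt : 0 < Δt) (hlt : dtMax (lambdaMin (LPCG ι q L00 M μ u)) < ENNReal.ofReal Δt)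
    {t : Set (∀ k, X k)} (ht : t ∈ 𝓝 u) :
    ∃ ε > 0, ∀ δ > 0, ∃ u₀, ‖u₀ - u‖ < δ ∧ ∃ n, (∀ m < n, (step ι q C L00 M Δt)^[m] u₀ ∈ t) ∧
      ε ≤ ‖(step ι q C L00 M Δt)^[n] u₀ - u‖ := by
  have hdet := hu.gram_det_ne_zero hq hM
  have hstep := hu.hasQuadraticError_step (Δt := Δt) hq hdet hL00
  rw [← hstep.hasFDerivAt.fderiv] at hstep
  have hDQ := hu.fderiv_step_mul_kerProj (Δt := Δt) hq hdet hL00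
  rw [LPCG_eq] at hlt hDQ
  obtain ⟨ρ, hρ, ⟨b, hb⟩, c, hc, hfreq⟩ := hM.exists_pow_growth_of_dtMax_lt
    (kerProj_mul_self hdet) (apply_kerProj_comm hM hdet) (apply_symm_comp_flip hM)
    (hu.kerProj_mul_fderiv_step hq hdet hL00) hDQ hΔt hlt
  exact exists_escape_of_growth hstep (hu.step_eq_self hq hdet) hρ hb hc hfreq ht

end Convergence

end PCSOM

end

theorem theorem5 {N r K s : ℕ} (hr : 1 ≤ r) (hrK : r ≤ K)
    {X : Fin K → Type*} [∀ k, NormedAddCommGroup (X k)] [∀ k, NormedSpace ℝ (X k)]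
    [∀ k, CompleteSpace (X k)]
    (ι : ∀ k, X k →L[ℝ] PCSOM.L2 N) (hι : ∀ k, Function.Injective (ι k))
    -- the coefficients of the quadratic quantities, in reduced echelon form
    (q : Matrix (Fin r) (Fin K) ℝ)
    (hq : ∀ i j : Fin r, q i (Fin.castLE hrK j) = if i = j then 1 else 0)
    (C : Fin r → ℝ)
    (L00 : (∀ k, X k) → ((∀ k, X k) →L[ℝ] ℝ))
    -- the acceleration operator, Hermitian and positive definite
    (M : (∀ k, X k) ≃L[ℝ] ((∀ k, X k) →L[ℝ] ℝ))
    (hMsymm : ∀ v w, M v w = M w v) (hMpos : ∀ v, v ≠ 0 → 0 < M v v)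
    -- the family of solitary waves `U c μ`, and the wave `u` in it
    (U : (Fin s → ℝ) → (Fin r → ℝ) → ∀ k, X k) (c₀ : Fin s → ℝ) (μ₀ : Fin r → ℝ)
    (u : ∀ k, X k) (hu : u = U c₀ μ₀)
    (hU : ContDiffAt ℝ 1 (fun p : (Fin s → ℝ) × (Fin r → ℝ) => U p.1 p.2) (c₀, μ₀))
    (hUsol : ∀ᶠ p : (Fin s → ℝ) × (Fin r → ℝ) in 𝓝 (c₀, μ₀),
      PCSOM.L0 ι q L00 p.2 (U p.1 p.2) = 0)
    (hL00 : ContDiffAt ℝ 2 L00 u)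
    (hC : ∀ j, PCSOM.quad ι q j u = C j)
    (hne : ∀ k : Fin K, (k : ℕ) < r → u k ≠ 0)
    -- the kernel of `L₁` consists of the invariance modes
    (hker : LinearMap.ker (PCSOM.L1 ι q L00 μ₀ u).toLinearMap =
      Submodule.span ℝ (range (PCSOM.invarianceMode (fun c => U c μ₀) c₀)))
    -- the columns of `B` are orthogonal to the kernel of `L₁`
    (hB : ∀ j, ∀ Ψ, PCSOM.L1 ι q L00 μ₀ u Ψ = 0 → PCSOM.colB ι q u j Ψ = 0)
    (hD : (PCSOM.Dhat ι q (U c₀) μ₀).det ≠ 0)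
    (Δt : ℝ) (hΔt : 0 < Δt) :
    -- convergence (given that the nonzero spectrum does not accumulate at zero)
    (IsClosed (range (PCSOM.L1 ι q L00 μ₀ u)) →
      ENNReal.ofReal Δt < PCSOM.dtMax (PCSOM.lambdaMin (PCSOM.LPCG ι q L00 M μ₀ u)) →
      ∀ ε > 0, ∃ δ > 0, ∀ u₀ : ∀ k, X k, ‖u₀ - u‖ < δ →
        (∀ n : ℕ, PCSOM.StepDefined ι q C L00 M Δt ((PCSOM.step ι q C L00 M Δt)^[n] u₀) ∧
          ‖(PCSOM.step ι q C L00 M Δt)^[n] u₀ - u‖ < ε) ∧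
        ∃ (c : Fin s → ℝ) (μ : Fin r → ℝ), ‖c - c₀‖ < ε ∧ ‖μ - μ₀‖ < ε ∧
          PCSOM.L0 ι q L00 μ (U c μ) = 0 ∧ (∀ j, PCSOM.quad ι q j (U c μ) = C j) ∧
          Tendsto (fun n : ℕ => (PCSOM.step ι q C L00 M Δt)^[n] u₀) atTop (𝓝 (U c μ))) ∧
    -- divergence
    (PCSOM.dtMax (PCSOM.lambdaMin (PCSOM.LPCG ι q L00 M μ₀ u)) < ENNReal.ofReal Δt →
      ∃ ε > 0, ∀ δ > 0, ∃ u₀ : ∀ k, X k, ‖u₀ - u‖ < δ ∧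
        ∃ n : ℕ, (∀ m < n, PCSOM.StepDefined ι q C L00 M Δt
            ((PCSOM.step ι q C L00 M Δt)^[m] u₀)) ∧
          ε ≤ ‖(PCSOM.step ι q C L00 M Δt)^[n] u₀ - u‖) := by
  subst hu
  have hwave : PCSOM.IsSolitaryWave ι q C L00 μ₀ (U c₀ μ₀) :=
    ⟨hUsol.self_of_nhds, hC, fun k hk => PCSOM.power_pos_of_ne_zero (hι k) (hne k hk)⟩
  have hM : PCSOM.IsHermitianPosDef M := ⟨hMsymm, hMpos⟩
  have hdefined := hwave.eventually_stepDefined (Δt := Δt) (M := M) hq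
    (hwave.gram_det_ne_zero hq hM) hL00
  refine ⟨fun hclosed hlt ε hε => ?_, fun hlt => hwave.exists_escape_step hq hM hL00 hΔt hlt
    hdefined⟩
  obtain ⟨δ, hδ, hconv⟩ := Metric.eventually_nhds_iff_ball.1 (hwave.eventually_tendsto_step hq hM
    hU hUsol hL00 hker hB hD hclosed hΔt hlt (inter_mem hdefined (Metric.ball_mem_nhds _ hε))
    (prod_mem_nhds (Metric.ball_mem_nhds _ hε) (Metric.ball_mem_nhds _ hε)))
  simp only [mem_ball_iff_norm, mem_inter_iff, mem_prod] at hconv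
  refine ⟨δ, hδ, fun u₀ hu₀ => ?_⟩
  obtain ⟨hiter, c, μ, hcμ, hsol, hlim⟩ := hconv u₀ hu₀
  exact ⟨hiter, c, μ, hcμ.1, hcμ.2, hsol.L0_eq_zero, hsol.quad_eq, hlim⟩
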